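/- Let $\kappa$ be a regular uncountable cardinal that is subtle, i.e., for every sequence $\langle A_\beta\mid\beta\in D\rangle$ over a club $D\subseteq\kappa$ there are $\beta<\alpha$ in $D$ with $A_\beta\cap\beta=A_\alpha\cap\beta$. Suppose that $\boxtimes^-(\kappa)=P^-(\kappa,2,\sqsubseteq,1)$ holds or, alternatively, that $P(\kappa,2,\sqsubseteq^*,1)$, i.e., $P^-(\kappa,2,\sqsubseteq^*,1)$ together with $\diamondsuit(\kappa)$, holds. Then there exists a streamlined, normal, prolific, full $\kappa$-Souslin tree. Here, for a set $C$ of ordinals, $\operatorname{acc}(C)=\{\alpha\in C\mid\sup(C\cap\alpha)=\alpha>0\}$ and $\operatorname{nacc}(C)=C\setminus\operatorname{acc}(C)$. For $\mathcal R\in\{\sqsubseteq,\sqsubseteq^*\}$, the principle $P^-(\kappa,2,\mathcal R,1)$ asserts that there is a sequence $\langle C_\alpha\mid\alpha<\kappa\rangle$ such that each $C_\alpha$ is a closed subset of $\alpha$ with $\sup(C_\alpha)=\sup(\alpha)$; $C_\beta\mathrel{\mathcal R}C_\alpha$ whenever $\beta\in\operatorname{acc}(C_\alpha)$; and for every cofinal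 $B\subseteq\kappa$ there are stationarily many $\alpha<\kappa$ with $\sup(\operatorname{nacc}(C_\alpha)\cap B)=\alpha$. $D\sqsubseteq C$ means that $D=C\cap\beta$ for some ordinal $\beta$, and $D\sqsubseteq^*C$ means that $D\setminus\varepsilon\sqsubseteq C\setminus\varepsilon$ for some $\varepsilon<\sup(D)$. $\diamondsuit(\kappa)$ asserts that there are functions $\langle f_\beta\mid\beta<\kappa\rangle$ such that for every $f:\kappa\to\kappa$ the set $\{\beta<\kappa\mid f\restriction\beta=f_\beta\}$ is stationary in $\kappa$. A streamlined $\kappa$-tree is a set $T$ of functions from ordinals below $\kappa$ to $H_\kappa$ (the collection of all sets of hereditary cardinality less than $\kappa$) that is closed under restrictions to ordinals and such that for each $\alpha<\kappa$ the set $T_\alpha$ of all members of $T$ with domain $\alpha$ is nonempty and of size less than $\kappa$; it is ordered by inclusion. It is prolific iff $t^\smallfrown\langle i\rangle\in T$ for all $\alpha<\kappa$, $t\in T_\alpha$ and $i<\max\{\omega,\alpha\}$. It is normal iff for all $\bar\alpha<\alpha<\kappa$ every $x\in T_{\bar\alpha}$ is properly extended by some $y\in T_\alpha$. It is full iff for every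 limit ordinal $\alpha<\kappa$ there is at most one $\alpha$-branch (a chain whose elements have as heights exactly the ordinals below $\alpha$) with no upper bound in $T$. It is $\kappa$-Souslin iff it has no $\kappa$-branches and no antichains of size $\kappa$. -/

import Mathlib

universe u v

namespace FullSouslin

open Set Cardinal Ordinal

/-! ### Sets of ordinals -/

/-- `D` is a club (closed and unbounded subset) in the ordinal `o`. -/
def IsClubIn (o : Ordinal.{u}) (D : Set Ordinal.{u}) : Prop :=
  D ⊆ Iio o ∧ IsClub {x : Iio o | x.1 ∈ D}

/-- `S` is a stationary subset of the ordinal `o`. -/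
def IsStationaryIn (o : Ordinal.{u}) (S : Set Ordinal.{u}) : Prop :=
  S ⊆ Iio o ∧ IsStationary {x : Iio o | x.1 ∈ S}

/-- `B` is a cofinal subset of the ordinal `o`. -/
def IsCofinalIn (o : Ordinal.{u}) (B : Set Ordinal.{u}) : Prop :=
  B ⊆ Iio o ∧ IsCofinal {x : Iio o | x.1 ∈ B}

/-- The accumulation points of `C` that belong to `C`. -/
def acc (C : Set Ordinal.{u}) : Set Ordinal.{u} :=
  {α ∈ C | sSup (C ∩ Iio α) = α ∧ 0 < α}

/-- The non-accumulation points of `C`. -/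
def nacc (C : Set Ordinal.{u}) : Set Ordinal.{u} :=
  C \ acc C

/-- A cardinal `κ` is subtle iff for every sequence `⟨A β ∣ β ∈ D⟩` over a club `D ⊆ κ` there are
`β < α` in `D` with `A β ∩ β = A α ∩ β`. -/
def IsSubtle (κ : Cardinal.{u}) : Prop :=
  ∀ D : Set Ordinal.{u}, IsClubIn κ.ord D → ∀ A : Ordinal.{u} → Set Ordinal.{u},
    ∃ β ∈ D, ∃ α ∈ D, β < α ∧ A β ∩ Iio β = A α ∩ Iio β

/-- Jensen's diamond principle for `κ`. Here `F β` represents a function with domain `β`: only its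
values below `β` matter. -/
def Diamond (κ : Cardinal.{u}) : Prop :=
  ∃ F : Ordinal.{u} → Ordinal.{u} → Ordinal.{u},
    ∀ f : Ordinal.{u} → Ordinal.{u}, (∀ γ < κ.ord, f γ < κ.ord) →
      IsStationaryIn κ.ord {β | β < κ.ord ∧ ∀ γ < β, f γ = F β γ}

/-! ### C-sequences and the proxy principle -/

/-- `C` is a closed subset of the ordinal `α`. -/
def IsClosedSubset (α : Ordinal.{u}) (C : Set Ordinal.{u}) : Prop :=
  C ⊆ Iio α ∧ ∀ δ < α, 0 < δ → sSup (C ∩ Iio δ) = δ → δ ∈ C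

/-- `⟨C α ∣ α < κ⟩` is a `C`-sequence over `κ`. -/
def IsCSequence (κ : Cardinal.{u}) (C : Ordinal.{u} → Set Ordinal.{u}) : Prop :=
  ∀ α < κ.ord, IsClosedSubset α (C α) ∧ sSup (C α) = sSup (Iio α)

/-- `R`-coherence of a `C`-sequence over `κ`. -/
def IsCoherent (κ : Cardinal.{u}) (R : Set Ordinal.{u} → Set Ordinal.{u} → Prop)
    (C : Ordinal.{u} → Set Ordinal.{u}) : Prop :=
  ∀ α < κ.ord, ∀ β < α, β ∈ acc (C α) → R (C β) (C α)

/-- `D ⊑ C`: the set `D` is an initial segment of `C`. -/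
def InitSeg (D C : Set Ordinal.{u}) : Prop :=
  ∃ β : Ordinal.{u}, D = C ∩ Iio β

/-- `D ⊑* C`: for some `ε < sup D`, the set `D \ ε` is an initial segment of `C \ ε`. -/
def InitSegStar (D C : Set Ordinal.{u}) : Prop :=
  ∃ ε < sSup D, InitSeg (D \ Iio ε) (C \ Iio ε)

/-- The principle `P⁻(κ, 2, R, θ, 𝒮)`. -/
def ProxyMinus (κ : Cardinal.{u}) (R : Set Ordinal.{u} → Set Ordinal.{u} → Prop)
    (θ : Cardinal.{u}) (𝒮 : Set (Set Ordinal.{u})) : Prop :=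
  ∃ C : Ordinal.{u} → Set Ordinal.{u}, IsCSequence κ C ∧ IsCoherent κ R C ∧
    ∀ B : Ordinal.{u} → Set Ordinal.{u}, (∀ i < θ.ord, IsCofinalIn κ.ord (B i)) →
      ∀ S ∈ 𝒮, IsStationaryIn κ.ord
        {α ∈ S | ∀ i < min α θ.ord, sSup (nacc (C α) ∩ B i) = α}

/-- The principle `P(κ, 2, R, θ, 𝒮)`. -/
def Proxy (κ : Cardinal.{u}) (R : Set Ordinal.{u} → Set Ordinal.{u} → Prop)
    (θ : Cardinal.{u}) (𝒮 : Set (Set Ordinal.{u})) : Prop :=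
  ProxyMinus κ R θ 𝒮 ∧ Diamond κ

/-- The principle `⊠⁻(κ)`, that is, `P⁻(κ, 2, ⊑, 1, {κ})`. -/
def BoxtimesMinus (κ : Cardinal.{u}) : Prop :=
  ProxyMinus κ InitSeg 1 {Iio κ.ord}

/-! ### Abstract trees -/

section AbstractTrees

variable {X : Type v} [PartialOrder X]

/-- The set of predecessors of `x` is well-ordered with order type `α`. -/
def HasHeight (x : X) (α : Ordinal.{u}) : Prop :=
  Nonempty (Iio x ≃o Iio α)

/-- `B` is an `α`-branch: a chain whose elements have as heights exactly the ordinals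
below `α`. -/
def IsBranch (α : Ordinal.{u}) (B : Set X) : Prop :=
  IsChain (· ≤ ·) B ∧ ∀ β : Ordinal.{u}, (∃ x ∈ B, HasHeight x β) ↔ β < α

/-- A set of nodes is vanishing iff it has no upper bound in the tree. -/
def IsVanishing (B : Set X) : Prop :=
  ¬ ∃ y : X, ∀ x ∈ B, x ≤ y

variable (X)

/-- `X` is a `κ`-tree: a tree of height `κ` all of whose levels have size less than `κ`. -/
def IsTreeOf (κ : Cardinal.{u}) : Prop :=
  (∀ x : X, ∃ α < κ.ord, HasHeight x α) ∧
  ∀ α < κ.ord, {x : X | HasHeight x α}.Nonempty ∧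
    lift.{u} #{x : X | HasHeight x α} < lift.{v} κ

/-- A `κ`-tree is full iff for every limit `α < κ` it has at most one vanishing `α`-branch. -/
def IsFull (κ : Cardinal.{u}) : Prop :=
  ∀ α < κ.ord, Order.IsSuccLimit α →
    {B : Set X | IsBranch α B ∧ IsVanishing B}.Subsingleton

/-- A `κ`-tree is normal iff every node has extensions in all higher levels. -/
def IsNormalTree (κ : Cardinal.{u}) : Prop :=
  ∀ α < κ.ord, ∀ β < α, ∀ x : X, HasHeight x β → ∃ y : X, HasHeight y α ∧ x < y

/-- A `κ`-Souslin tree: a `κ`-tree with no `κ`-branches and no antichains of size `κ`. -/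
def IsSouslin (κ : Cardinal.{u}) : Prop :=
  IsTreeOf X κ ∧ (¬ ∃ B : Set X, IsBranch κ.ord B) ∧
  ¬ ∃ A : Set X, IsAntichain (· ≤ ·) A ∧ lift.{u} #A = lift.{v} κ

end AbstractTrees

/-! ### Streamlined trees -/

/-- `H_κ`: the sets whose transitive closure has size less than `κ`. -/
def HSet (κ : Cardinal.{u}) : Set ZFSet.{u} :=
  {x | ∃ y : ZFSet.{u}, y.IsTransitive ∧ x ⊆ y ∧ y.card < κ}

/-- A transfinite sequence of sets: a function whose domain is an ordinal. -/
structure TransSeq : Type (u + 1) where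
  /-- The domain of the sequence. -/
  dom : Ordinal.{u}
  /-- The values of the sequence. -/
  val : Iio dom → ZFSet.{u}

namespace TransSeq

/-- Sequences are ordered by end-extension, that is, by inclusion of functions. -/
instance : PartialOrder TransSeq.{u} where
  le s t := ∃ h : s.dom ≤ t.dom, ∀ x : Iio s.dom, s.val x = t.val ⟨x.1, lt_of_lt_of_le x.2 h⟩
  le_refl _ := ⟨le_rfl, fun _ => rfl⟩
  le_trans _ _ _ h₁ h₂ := ⟨h₁.1.trans h₂.1, fun x => (h₁.2 x).trans (h₂.2 _)⟩
  le_antisymm := by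
    rintro ⟨a, f⟩ ⟨b, g⟩ ⟨h₁, h₂⟩ ⟨h₃, _⟩
    obtain rfl : a = b := le_antisymm h₁ h₃
    congr 1
    exact funext h₂

/-- The restriction `t ↾ α`. -/
noncomputable def restrict (t : TransSeq.{u}) (α : Ordinal.{u}) : TransSeq.{u} where
  dom := min α t.dom
  val x := t.val ⟨x.1, lt_of_lt_of_le (mem_Iio.1 x.2) (min_le_right α t.dom)⟩

open Classical in
/-- The sequence `t ⌢ ⟨z⟩`. -/
noncomputable def snoc (t : TransSeq.{u}) (z : ZFSet.{u}) : TransSeq.{u} where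
  dom := Order.succ t.dom
  val x := if h : x.1 < t.dom then t.val ⟨x.1, h⟩ else z

end TransSeq

/-- `T` is a streamlined `κ`-tree: a downward-closed family of sequences of length less than `κ`
with values in `H_κ`, all of whose levels are nonempty and of size less than `κ`. -/
structure IsStreamlined (κ : Cardinal.{u}) (T : Set TransSeq.{u}) : Prop where
  /-- All the elements of `T` are sequences of length less than `κ`, with values in `H_κ`. -/
  seq : ∀ t ∈ T, t.dom < κ.ord ∧ ∀ x, t.val x ∈ HSet κ
  /-- `T` is downward-closed. -/
  restrict_mem : ∀ t ∈ T, ∀ α < κ.ord, t.restrict α ∈ T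
  /-- The levels are nonempty. -/
  level_nonempty : ∀ α < κ.ord, {t ∈ T | t.dom = α}.Nonempty
  /-- The levels have size less than `κ`. -/
  level_card : ∀ α < κ.ord, #{t : TransSeq.{u} | t ∈ T ∧ t.dom = α} < lift.{u + 1} κ

/-- `T` is prolific: for every `t ∈ T` of length `α`, the sequence `t ⌢ ⟨i⟩` is in `T` for all
`i < max ω α`. Here `i.toZFSet` is the von Neumann ordinal `i`. -/
def IsProlific (T : Set TransSeq.{u}) : Prop :=
  ∀ t ∈ T, ∀ i < max ω t.dom, t.snoc i.toZFSet ∈ T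

end FullSouslin

open FullSouslin

namespace FullSouslin

open Set Cardinal Ordinal

variable {κ : Cardinal.{u}}

/-! The tree consists of all sequences with `i`-th value below `max ω i`, except that at a level `δ`
of uncountable cofinality one branch may be left without a bound. Fullness is thus built in. The
omitted branch must not be canonical: a branch is canonical if it meets all demands attached to the
ladder `C δ` above some point of it. A demand asks the branch to enter a guessed dense set inside a
short interval, if some extension can.

Normality (`OmTree.extendible`): climb along `C α`, meeting all demands on the way. At an
accumulation point `δ` of `C α`, coherence turns a tail of the climb into a climb along `C δ`, so
the branch reached is canonical and hence was not omitted.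

Antichains: the construction depends on a parameter `k : ℕ`, and some `k` has to work. Subtlety
makes `κ` a strong limit and yields a diamond for countably many functions
(`IsSubtle.exists_guess`). Suppose each tree has an antichain `X k` of unbounded height, and guess
simultaneously the dense sets of nodes deciding `X k`. For club many `α`, if `α` has uncountable
cofinality, then some `k` admits correctly guessed demands above every point of `C α`
(`HasTaskAt.exists_uniform`). A member of `X k` above level `α` cannot decide `X k` below its own
level, so its restriction to `α` is not canonical, and tree `k` omits a branch at `α`. This
contradicts subtlety (`IsSubtle.false_of_omitted`): code `k` and the omitted branch at each such
`α`, and a cofinal `ω`-sequence where the cofinality is countable. If the codes at `β < α` agree,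
then either the branch omitted at `β` is a restriction of the one omitted at `α`, hence a node, or a
sequence bounded by `β` is cofinal in `α`.

Finally, an antichain of size `κ` has unbounded height since levels are small and the tree is
normal, and a `κ`-branch produces an antichain of unbounded height by splitting off it. -/

theorem exists_bound_of_small (hreg : κ.IsRegular) {ι : Type v}
    (hι : lift.{u} #ι < lift.{v} κ) (f : ι → Ordinal.{u}) (hf : ∀ i, f i < κ.ord) :
    ∃ b < κ.ord, ∀ i, f i < b := by
  obtain ⟨c, hc⟩ := Cardinal.mem_range_lift_of_le hι.le
  have e : Nonempty (ι ≃ c.out) := by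
    apply Cardinal.lift_mk_eq'.1
    rw [Cardinal.mk_out, hc]
  obtain ⟨e⟩ := e
  have hcκ : c < κ := by
    rw [← hc] at hι
    exact Cardinal.lift_lt.1 hι
  refine ⟨⨆ i, Order.succ (f (e.symm i)), ?_, fun i => ?_⟩
  · apply Ordinal.iSup_lt_of_lt_cof
    · rw [Cardinal.mk_out, hreg.cof_ord]; exact hcκ
    · intro i
      exact (isSuccLimit_ord hreg.aleph0_le).succ_lt (hf _)
  · rw [Ordinal.lt_iSup_iff]
    exact ⟨e i, by simp⟩

theorem exists_bound (hreg : κ.IsRegular) {ι : Type (u + 1)}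
    (hι : #ι < lift.{u + 1} κ) (f : ι → Ordinal.{u}) (hf : ∀ i, f i < κ.ord) :
    ∃ b < κ.ord, ∀ i, f i < b :=
  exists_bound_of_small hreg (by rwa [Cardinal.lift_id'.{u, u + 1}]) f hf

theorem mk_Iio_lt {ξ : Ordinal.{u}} (h : ξ < κ.ord) : #(Iio ξ) < lift.{u + 1} κ := by
  rw [Cardinal.mk_Iio_ordinal, Cardinal.lift_lt]
  exact lt_ord.1 h

theorem mk_Iic_lt (hreg : κ.IsRegular) {ξ : Ordinal.{u}} (h : ξ < κ.ord) :
    #(Iic ξ) < lift.{u + 1} κ := by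
  rw [← Order.Iio_succ]
  exact mk_Iio_lt ((isSuccLimit_ord hreg.aleph0_le).succ_lt h)

theorem exists_bound_nat (hreg : κ.IsRegular) (hunc : Cardinal.aleph0 < κ) (f : ℕ → Ordinal.{u})
    (hf : ∀ i, f i < κ.ord) : ∃ b < κ.ord, ∀ i, f i < b :=
  exists_bound_of_small hreg (by simpa using hunc) f hf

/-! ### Clubs as sets of closure points. -/

/-- The club filter on `κ`. -/
def OnClub (κ : Cardinal.{u}) (P : Ordinal.{u} → Prop) : Prop :=
  ∃ g : Ordinal.{u} → Ordinal.{u}, (∀ ξ < κ.ord, g ξ < κ.ord) ∧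
    ∀ δ < κ.ord, 0 < δ → (∀ ξ < δ, g ξ < δ) → P δ

theorem OnClub.mono {P Q : Ordinal.{u} → Prop} (h : OnClub κ P)
    (hPQ : ∀ δ < κ.ord, 0 < δ → P δ → Q δ) : OnClub κ Q := by
  obtain ⟨g, hg, h⟩ := h
  exact ⟨g, hg, fun δ hδ h0 hc => hPQ δ hδ h0 (h δ hδ h0 hc)⟩

theorem OnClub.and {P Q : Ordinal.{u} → Prop} (hP : OnClub κ P) (hQ : OnClub κ Q) :
    OnClub κ fun δ => P δ ∧ Q δ := by
  obtain ⟨g, hg, hP⟩ := hP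
  obtain ⟨g', hg', hQ⟩ := hQ
  refine ⟨fun ξ => max (g ξ) (g' ξ), fun ξ h => max_lt (hg ξ h) (hg' ξ h),
    fun δ h h0 hc => ⟨?_, ?_⟩⟩
  · exact hP δ h h0 fun ξ hξ => (le_max_left _ _).trans_lt (hc ξ hξ)
  · exact hQ δ h h0 fun ξ hξ => (le_max_right _ _).trans_lt (hc ξ hξ)

theorem onClub_exists_lt {Q : Ordinal.{u} → Ordinal.{u} → Prop}
    (h : ∀ ξ < κ.ord, ∃ b < κ.ord, Q ξ b) : OnClub κ fun δ => ∀ ξ < δ, ∃ b < δ, Q ξ b := by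
  have : ∀ ξ : Ordinal.{u}, ∃ b, ξ < κ.ord → b < κ.ord ∧ Q ξ b := by
    intro ξ
    by_cases hξ : ξ < κ.ord
    · obtain ⟨b, hb⟩ := h ξ hξ
      exact ⟨b, fun _ => hb⟩
    · exact ⟨0, fun h' => absurd h' hξ⟩
  choose g hg using this
  exact ⟨g, fun ξ hξ => (hg ξ hξ).1, fun δ hδ _ hc ξ hξ =>
    ⟨g ξ, hc ξ hξ, (hg ξ (hξ.trans hδ)).2⟩⟩

theorem onClub_closed {g : Ordinal.{u} → Ordinal.{u}} (hg : ∀ ξ < κ.ord, g ξ < κ.ord) :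
    OnClub κ fun δ => ∀ ξ < δ, g ξ < δ :=
  ⟨g, hg, fun _ _ _ h => h⟩

theorem exists_iSup_nat {f : ℕ → Ordinal.{u}} {ξ : Ordinal.{u}} : ξ < ⨆ n, f n ↔ ∃ n, ξ < f n :=
  Ordinal.lt_iSup_iff

theorem iSup_nat_lt (hreg : κ.IsRegular) (hunc : Cardinal.aleph0 < κ) {f : ℕ → Ordinal.{u}}
    (hf : ∀ i, f i < κ.ord) : ⨆ n, f n < κ.ord := by
  obtain ⟨b, hb, h⟩ := exists_bound_nat hreg hunc f hf
  exact (Ordinal.iSup_le fun i => (h i).le).trans_lt hb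

theorem isClubIn_closure (hreg : κ.IsRegular) (hunc : Cardinal.aleph0 < κ)
    {g : Ordinal.{u} → Ordinal.{u}} (hg : ∀ ξ < κ.ord, g ξ < κ.ord) :
    IsClubIn κ.ord {δ | δ < κ.ord ∧ 0 < δ ∧ ∀ ξ < δ, g ξ < δ} := by
  have hlim := isSuccLimit_ord hreg.aleph0_le
  refine ⟨fun x hx => hx.1, ⟨?_, ?_⟩⟩
  · intro d hd hne _ a ha
    obtain ⟨e, he⟩ := hne
    refine ⟨a.2, lt_of_lt_of_le (hd he).2.1 (ha.1 he), fun ξ hξ => ?_⟩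
    have : ∃ e ∈ d, ξ < e.1 := by
      by_contra hcon
      push Not at hcon
      have : a ≤ ⟨ξ, hξ.trans a.2⟩ := ha.2 fun e he => hcon e he
      exact absurd hξ (not_lt.2 this)
    obtain ⟨e, he, hξe⟩ := this
    exact ((hd he).2.2 ξ hξe).trans_le (ha.1 he)
  · intro x
    have : ∀ ξ : Ordinal.{u}, ∃ b, ξ < κ.ord → b < κ.ord ∧ ξ < b ∧ ∀ i ≤ ξ, g i < b := by
      intro ξ
      by_cases hξ : ξ < κ.ord
      · obtain ⟨b, hb, h⟩ := exists_bound (ι := Iic ξ) hreg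
          (mk_Iic_lt hreg hξ) (fun i => g i.1) (fun i => hg _ (lt_of_le_of_lt i.2 hξ))
        exact ⟨max b (Order.succ ξ), fun _ => ⟨max_lt hb (hlim.succ_lt hξ), by simp,
          fun i hi => (h ⟨i, hi⟩).trans_le (le_max_left _ _)⟩⟩
      · exact ⟨0, fun h' => absurd h' hξ⟩
    choose h hh using this
    have hlt : ∀ n, h^[n] x.1 < κ.ord := by
      intro n
      induction n with
      | zero => exact x.2
      | succ n ih => rw [Function.iterate_succ_apply']; exact (hh _ ih).1
    have hst : ∀ n, h^[n] x.1 < h^[n + 1] x.1 := fun n => by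
      rw [Function.iterate_succ_apply']; exact (hh _ (hlt n)).2.1
    have hx : x.1 < ⨆ n, h^[n] x.1 := exists_iSup_nat.2 ⟨1, hst 0⟩
    refine ⟨⟨⨆ n, h^[n] x.1, iSup_nat_lt hreg hunc hlt⟩,
      ⟨iSup_nat_lt hreg hunc hlt, hx.bot_lt, fun ξ hξ => ?_⟩, hx.le⟩
    obtain ⟨n, hn⟩ := exists_iSup_nat.1 hξ
    refine exists_iSup_nat.2 ⟨n + 1, ?_⟩
    rw [Function.iterate_succ_apply']
    exact (hh _ (hlt n)).2.2 ξ hn.le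

theorem IsStationaryIn.exists_onClub (hreg : κ.IsRegular) (hunc : Cardinal.aleph0 < κ)
    {S : Set Ordinal.{u}} (hS : IsStationaryIn κ.ord S) {P : Ordinal.{u} → Prop}
    (hP : OnClub κ P) : ∃ δ ∈ S, δ < κ.ord ∧ P δ := by
  obtain ⟨g, hg, h⟩ := hP
  obtain ⟨x, hx, hx'⟩ := hS.2 (isClubIn_closure hreg hunc hg).2
  exact ⟨x.1, hx, x.2, h _ x.2 hx'.2.1 hx'.2.2⟩

theorem OnClub.limit (hreg : κ.IsRegular) :
    OnClub κ fun δ => 0 < δ ∧ ∀ ξ < δ, Order.succ ξ < δ :=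
  (onClub_closed fun _ hξ => (isSuccLimit_ord hreg.aleph0_le).succ_lt hξ).mono
    fun _ _ h0 h => ⟨h0, h⟩

/-! ### Consequences of subtlety: coded sequences, strong limit, diamond. -/

/-- Injective coding of triples below `κ`. -/
theorem exists_triple_code (hreg : κ.IsRegular) :
    ∃ e : ℕ → Ordinal.{u} → Ordinal.{u} → Ordinal.{u},
      (∀ n, ∀ i < κ.ord, ∀ j < κ.ord, e n i j < κ.ord) ∧
      ∀ n n', ∀ i < κ.ord, ∀ i' < κ.ord, ∀ j < κ.ord, ∀ j' < κ.ord,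
        e n i j = e n' i' j' → n = n' ∧ i = i' ∧ j = j' := by
  have hκ : #(Iio κ.ord) = lift.{u + 1} κ := by rw [Cardinal.mk_Iio_ordinal, card_ord]
  have hinf : Cardinal.aleph0 ≤ lift.{u + 1} κ := by simpa using hreg.aleph0_le
  have : #(ℕ × Iio κ.ord × Iio κ.ord) ≤ #(Iio κ.ord) := by
    simp only [mk_prod, Cardinal.lift_id, Cardinal.lift_uzero, hκ, Cardinal.mk_nat,
      Cardinal.lift_aleph0]
    rw [Cardinal.mul_eq_self hinf, Cardinal.aleph0_mul_eq hinf]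
  obtain ⟨f⟩ := (Cardinal.le_def _ _).1 this
  classical
  refine ⟨fun n i j => if h : i < κ.ord ∧ j < κ.ord then (f (n, ⟨i, h.1⟩, ⟨j, h.2⟩)).1 else 0,
    fun n i hi j hj => ?_, fun n n' i hi i' hi' j hj j' hj' h => ?_⟩
  · simp only [hi, hj, and_self, dif_pos]
    exact (f _).2
  · simp only [hi, hj, hi', hj', and_self, dif_pos] at h
    simpa [Prod.ext_iff, Subtype.ext_iff] using f.injective (Subtype.ext h)

/-- Subtlety is applied to the coded graphs of the `R α`. At levels closed under the code, the whole
graph of `R β` lies below `β`, so it survives intersection with `β` and can be read off, by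
injectivity, inside the graph of `R α`. -/
theorem IsSubtle.exists_eq_below (hreg : κ.IsRegular) (hunc : Cardinal.aleph0 < κ)
    (hsub : IsSubtle κ) {P : Ordinal.{u} → Prop} (hP : OnClub κ P)
    {R : Ordinal.{u} → ℕ → Ordinal.{u} → Ordinal.{u}}
    (hR : ∀ α < κ.ord, P α → ∀ n, ∀ i < α, R α n i < α) :
    ∃ β α, β < α ∧ 0 < β ∧ α < κ.ord ∧ P β ∧ P α ∧ ∀ n, ∀ i < β, R β n i = R α n i := by
  obtain ⟨e, he, hinj⟩ := exists_triple_code hreg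
  have hcl : OnClub κ fun δ => ∀ ξ < δ, ∃ b < δ, ∀ n, ∀ i ≤ ξ, ∀ j ≤ ξ, e n i j < b := by
    refine onClub_exists_lt fun ξ hξ => ?_
    obtain ⟨b, hb, h⟩ := exists_bound (ι := ℕ × Iic ξ × Iic ξ) hreg
      (by
        have h1 := mk_Iic_lt hreg hξ
        have h2 : Cardinal.aleph0 < lift.{u + 1} κ := by simpa using hunc
        simp only [mk_prod, Cardinal.lift_id, Cardinal.lift_uzero, Cardinal.mk_nat,
          Cardinal.lift_aleph0]
        exact Cardinal.mul_lt_of_lt h2.le h2 (Cardinal.mul_lt_of_lt h2.le h1 h1))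
      (fun p => e p.1 p.2.1.1 p.2.2.1)
      (fun p => he _ _ (p.2.1.2.trans_lt hξ) _ (p.2.2.2.trans_lt hξ))
    exact ⟨b, hb, fun n i hi j hj => h (n, ⟨i, hi⟩, ⟨j, hj⟩)⟩
  obtain ⟨g, hg, h⟩ := hP.and hcl
  obtain ⟨β, hβ, α, hα, hlt, heq⟩ := hsub _ (isClubIn_closure hreg hunc hg)
    fun α => {x | ∃ n, ∃ i < α, x = e n i (R α n i)}
  obtain ⟨hPβ, hcβ⟩ := h β hβ.1 hβ.2.1 hβ.2.2
  obtain ⟨hPα, hcα⟩ := h α hα.1 hα.2.1 hα.2.2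
  refine ⟨β, α, hlt, hβ.2.1, hα.1, hPβ, hPα, fun n i hi => ?_⟩
  have hr := hR β hβ.1 hPβ n i hi
  obtain ⟨b, hb, hbd⟩ := hcβ _ (max_lt hi hr)
  have hmem : e n i (R β n i) ∈ {x | ∃ n, ∃ i < β, x = e n i (R β n i)} ∩ Iio β :=
    ⟨⟨n, i, hi, rfl⟩, (hbd n i (le_max_left _ _) _ (le_max_right _ _)).trans hb⟩
  simp only [heq] at hmem
  obtain ⟨⟨n', i', hi', hee⟩, _⟩ := hmem
  obtain ⟨rfl, rfl, h3⟩ := hinj _ _ _ (hi.trans hβ.1) _ (hi'.trans hα.1) _ (hr.trans hβ.1) _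
    ((hR α hα.1 hPα n' i' hi').trans hα.1) hee
  exact h3

/-- Otherwise there are `κ` distinct subsets of `c`. Used as a sequence over a club above `c`, they
are unchanged by intersection with `β`, so subtlety would make two of them equal. -/
theorem IsSubtle.two_power_lt (hreg : κ.IsRegular) (hunc : Cardinal.aleph0 < κ)
    (hsub : IsSubtle κ) {c : Cardinal.{u}} (hc : c < κ) : 2 ^ c < κ := by
  by_contra hcon
  push Not at hcon
  have hle : #(Iio κ.ord) ≤ #(Set (Iio c.ord)) := by
    rw [Cardinal.mk_set, Cardinal.mk_Iio_ordinal, Cardinal.mk_Iio_ordinal, card_ord, card_ord,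
      ← Cardinal.lift_two_power]
    exact Cardinal.lift_le.2 hcon
  obtain ⟨f⟩ := (Cardinal.le_def _ _).1 hle
  have hP : OnClub κ fun δ => c.ord < δ := by
    refine ⟨fun _ => c.ord, fun _ _ => Cardinal.ord_lt_ord.2 hc, fun δ _ h0 h => h 0 h0⟩
  classical
  obtain ⟨g, hg, hP⟩ := hP
  obtain ⟨β, hβ, α, hα, hlt, heq⟩ := hsub _ (isClubIn_closure hreg hunc hg)
    fun α => if h : α < κ.ord then Subtype.val '' f ⟨α, h⟩ else ∅
  simp only [hβ.1, hα.1, dif_pos] at heq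
  have h1 := hP β hβ.1 hβ.2.1 hβ.2.2
  have hsubs : ∀ δ, c.ord < δ → ∀ s : Set (Iio c.ord),
      Subtype.val '' s ∩ Iio δ = Subtype.val '' s := by
    intro δ hδ s
    refine inter_eq_left.2 ?_
    rintro _ ⟨x, _, rfl⟩
    exact lt_trans x.2 hδ
  rw [hsubs β h1, inter_eq_left.2] at heq
  · have := f.injective (Subtype.val_injective.image_injective heq)
    exact hlt.ne (congrArg Subtype.val this)
  · rintro _ ⟨x, _, rfl⟩
    exact lt_trans x.2 h1

/-- Diamond, guessing countably many functions at once. -/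
theorem IsSubtle.exists_guess (hreg : κ.IsRegular) (hunc : Cardinal.aleph0 < κ)
    (hsub : IsSubtle κ) : ∃ G : Ordinal.{u} → ℕ → Ordinal.{u} → Ordinal.{u},
      ∀ F : ℕ → Ordinal.{u} → Ordinal.{u}, (∀ n, ∀ i < κ.ord, F n i < κ.ord) →
        ∀ P, OnClub κ P → ∃ β < κ.ord, P β ∧ ∀ n, ∀ i < β, F n i = G β n i := by
  classical
  -- `G α` will be a sequence not guessed at any earlier level, whenever there is one. Slot `0`
  -- carries the function whose closure points form the club to be met.
  let Cex (α : Ordinal.{u}) (prev : ∀ β < α, ℕ → Ordinal.{u} → Ordinal.{u})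
      (H : ℕ → Ordinal.{u} → Ordinal.{u}) : Prop :=
    (∀ n, ∀ i < α, H n i < α) ∧ ∀ β (hβ : β < α), 0 < β → (∀ i < β, H 0 i < β) →
      ¬ ∀ n, ∀ i < β, H n i = prev β hβ n i
  let st (α : Ordinal.{u}) (prev : ∀ β < α, ℕ → Ordinal.{u} → Ordinal.{u}) :
      ℕ → Ordinal.{u} → Ordinal.{u} :=
    if h : ∃ H, Cex α prev H then h.choose else fun _ _ => 0
  let G : Ordinal.{u} → ℕ → Ordinal.{u} → Ordinal.{u} := WellFoundedLT.fix st
  have hG : ∀ α, G α = st α fun β _ => G β := fun α => WellFoundedLT.fix_eq st α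
  have key : ∀ H : ℕ → Ordinal.{u} → Ordinal.{u}, (∀ n, ∀ i < κ.ord, H n i < κ.ord) →
      ∃ β < κ.ord, 0 < β ∧ (∀ i < β, H 0 i < β) ∧ ∀ n, ∀ i < β, H n i = G β n i := by
    intro H hH
    by_contra hcon
    push Not at hcon
    have hcl : OnClub κ fun δ => ∀ ξ < δ, ∃ b < δ, ∀ n, H n ξ < b :=
      onClub_exists_lt fun ξ hξ => exists_bound_nat hreg hunc _ fun n => hH n ξ hξ
    have hcex : ∀ α < κ.ord, (∀ ξ < α, ∃ b < α, ∀ n, H n ξ < b) → Cex α (fun β _ => G β) (G α) := by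
      intro α hα hc
      have hex : ∃ H, Cex α (fun β _ => G β) H := by
        refine ⟨H, fun n i hi => ?_, fun β hβ h0 h1 h2 => ?_⟩
        · obtain ⟨b, hb, h⟩ := hc i hi
          exact (h n).trans hb
        · obtain ⟨n, i, hi, hne⟩ := hcon β (hβ.trans hα) h0 h1
          exact hne (h2 n i hi)
      rw [hG α]
      simp only [st, dif_pos hex]
      exact hex.choose_spec
    -- Agreement of `G β` and `G α` below `β` means that the counterexample `G α` is guessed at `β`
    -- after all.
    obtain ⟨β, α, hlt, h0, hα, hβP, hαP, heq⟩ := hsub.exists_eq_below hreg hunc hcl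
      fun α hα hP n i hi => (hcex α hα hP).1 n i hi
    have hb := hcex β (hlt.trans hα) hβP
    have ha := hcex α hα hαP
    exact ha.2 β hlt h0 (fun i hi => heq 0 i hi ▸ hb.1 0 i hi) fun n i hi => (heq n i hi).symm
  refine ⟨fun β n => G β (n + 1), fun F hF P ⟨g, hg, hP⟩ => ?_⟩
  obtain ⟨β, hβ, h0, h1, h2⟩ := key (fun n => Nat.casesOn n g F)
    (fun n => by cases n; exacts [hg, hF _])
  exact ⟨β, hβ, hP β hβ h0 h1, fun n => h2 (n + 1)⟩

/-! ### Ladders obtained from the proxy principle. -/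

/-- `δ` is a limit of elements of `E`. -/
def IsLimitOf (E : Set Ordinal.{u}) (δ : Ordinal.{u}) : Prop :=
  0 < δ ∧ ∀ ξ < δ, ∃ e ∈ E, ξ < e ∧ e < δ

theorem isLimitOf_iff_sSup {E : Set Ordinal.{u}} {δ : Ordinal.{u}} :
    IsLimitOf E δ ↔ 0 < δ ∧ sSup (E ∩ Iio δ) = δ := by
  refine and_congr_right fun h0 => ⟨fun h => ?_, fun h ξ hξ => ?_⟩
  · obtain ⟨e, he, _, heδ⟩ := h 0 h0
    refine csSup_eq_of_forall_le_of_forall_lt_exists_gt ⟨e, he, heδ⟩ (fun x hx => hx.2.le)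
      fun w hw => ?_
    obtain ⟨e, he, h1, h2⟩ := h w hw
    exact ⟨e, ⟨he, h2⟩, h1⟩
  · have hne : (E ∩ Iio δ).Nonempty := by
      by_contra hne
      rw [not_nonempty_iff_eq_empty.1 hne] at h
      simp at h
      exact h0.ne h
    rw [← h] at hξ
    obtain ⟨e, he, h1⟩ := exists_lt_of_lt_csSup hne hξ
    exact ⟨e, he.1, h1, he.2⟩

theorem onClub_isLimitOf {E : Set Ordinal.{u}} (hE : ∀ ξ < κ.ord, ∃ e ∈ E, ξ < e ∧ e < κ.ord) :
    OnClub κ (IsLimitOf E) := by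
  have : OnClub κ fun δ => ∀ ξ < δ, ∃ b < δ, b ∈ E ∧ ξ < b :=
    onClub_exists_lt fun ξ hξ => by
      obtain ⟨e, h1, h2, h3⟩ := hE ξ hξ
      exact ⟨e, h3, h1, h2⟩
  refine this.mono fun δ _ h0 h => ⟨h0, fun ξ hξ => ?_⟩
  obtain ⟨b, h1, h2, h3⟩ := h ξ hξ
  exact ⟨b, h2, h3, h1⟩

/-- A `C`-sequence witnessing the proxy principle with coherence modulo bounded sets, where the
ladders at successor ordinals are singletons. -/
structure IsLadder (κ : Cardinal.{u}) (C : Ordinal.{u} → Set Ordinal.{u}) : Prop where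
  lt : ∀ α, ∀ β ∈ C α, β < α
  cof : ∀ α < κ.ord, ∀ ξ < α, ∃ β ∈ C α, ξ ≤ β
  closed : ∀ α < κ.ord, ∀ δ < α, IsLimitOf (C α) δ → δ ∈ C α
  coh : ∀ α < κ.ord, ∀ δ < α, IsLimitOf (C α) δ →
    ∃ ε < δ, ∀ c, ε ≤ c → c < δ → (c ∈ C δ ↔ c ∈ C α)
  guess : ∀ B : Set Ordinal.{u}, (∀ ξ < κ.ord, ∃ e ∈ B, ξ < e ∧ e < κ.ord) →
    ∀ P, OnClub κ P → ∃ γ < κ.ord, P γ ∧ 0 < γ ∧ ∀ ξ < γ, ∃ β ∈ C γ, β ∈ B ∧ ξ < β ∧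
      ∃ ρ < β, ∀ c ∈ C γ, c < β → c ≤ ρ

theorem InitSeg.initSegStar {D C : Set Ordinal.{u}} (h : InitSeg D C) (h0 : 0 < sSup D) :
    InitSegStar D C := ⟨0, h0, by simpa [Iio, not_lt_bot] using h⟩

theorem ProxyMinus.exists_isLadder (hreg : κ.IsRegular) (hunc : Cardinal.aleph0 < κ)
    (h : ProxyMinus κ InitSegStar 1 {Iio κ.ord}) : ∃ C, IsLadder κ C := by
  obtain ⟨C, hC, hcoh, hg⟩ := h
  -- Limit levels keep their ladder. Successors are reset to singletons because `sSup ∅ = 0` allows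
  -- `C 1` to be empty, which `cof` forbids.
  let L : Ordinal.{u} → Set Ordinal.{u} := fun α =>
    {β | β < α ∧ ((Order.IsSuccLimit α ∧ β ∈ C α) ∨ Order.succ β = α)}
  have hlimit : ∀ α δ, IsLimitOf (L α) δ → Order.IsSuccLimit δ := by
    intro α δ hδ
    refine isSuccLimit_iff.2 ⟨hδ.1.ne', ?_⟩
    rw [Order.isSuccPrelimit_iff_succ_lt]
    intro ξ hξ
    obtain ⟨e, _, h1, h2⟩ := hδ.2 ξ hξ
    exact (Order.succ_le_iff.2 h1).trans_lt h2
  have hLlim : ∀ α, Order.IsSuccLimit α → α < κ.ord → L α = C α := by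
    intro α hα hακ
    ext β
    refine ⟨fun hβ => ?_, fun hβ => ⟨((hC α hακ).1.1 hβ), Or.inl ⟨hα, hβ⟩⟩⟩
    rcases hβ.2 with h | h
    · exact h.2
    · exact absurd h (hα.succ_ne β)
  have hL2 : ∀ α δ, α < κ.ord → δ ≤ α → IsLimitOf (L α) δ → Order.IsSuccLimit α := by
    intro α δ hα hδα hδ
    by_contra hcon
    obtain ⟨e, he, h1, h2⟩ := hδ.2 0 hδ.1
    rcases he.2 with h | h
    · exact hcon h.1
    · have := (hlimit α δ hδ).succ_lt h2
      rw [h] at this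
      exact absurd hδα (not_le.2 this)
  have hcofl : ∀ α < κ.ord, Order.IsSuccLimit α → IsLimitOf (C α) α := by
    intro α hα hl
    have hsub : C α ⊆ Iio α := (hC α hα).1.1
    rw [isLimitOf_iff_sSup, inter_eq_left.2 hsub, (hC α hα).2]
    exact ⟨hl.bot_lt, hl.sSup_Iio⟩
  refine ⟨L, fun α β hβ => hβ.1, fun α hα ξ hξ => ?_, fun α hα δ hδ hlim => ?_,
    fun α hα δ hδ hlim => ?_, fun B hB P hP => ?_⟩
  · by_cases hl : Order.IsSuccLimit α
    · obtain ⟨e, he, h1, _⟩ := (hcofl α hα hl).2 ξ hξ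
      rw [hLlim α hl hα]
      exact ⟨e, he, h1.le⟩
    · obtain ⟨β, rfl⟩ : ∃ β, Order.succ β = α := by
        rcases zero_or_succ_or_isSuccLimit α with h | h | h
        · exact absurd hξ (by simp [h])
        · obtain ⟨β, hβ⟩ := h; exact ⟨β, hβ⟩
        · exact absurd h hl
      exact ⟨β, ⟨Order.lt_succ β, Or.inr rfl⟩, Order.lt_succ_iff.1 hξ⟩
  · have hl := hL2 α δ hα hδ.le hlim
    rw [hLlim α hl hα] at hlim ⊢
    have := isLimitOf_iff_sSup.1 hlim
    exact (hC α hα).1.2 δ hδ this.1 this.2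
  · have hl := hL2 α δ hα hδ.le hlim
    have hlδ := hlimit α δ hlim
    rw [hLlim α hl hα] at hlim ⊢
    rw [hLlim δ hlδ (hδ.trans hα)]
    have hs := isLimitOf_iff_sSup.1 hlim
    have hmem := (hC α hα).1.2 δ hδ hs.1 hs.2
    obtain ⟨ε, hε, β, hβ⟩ := hcoh α hα δ hδ ⟨hmem, hs.2, hs.1⟩
    have hsup : sSup (C δ) = δ := by
      rw [(hC δ (hδ.trans hα)).2]
      exact hlδ.sSup_Iio
    rw [hsup] at hε
    have hsub : C δ ⊆ Iio δ := (hC δ (hδ.trans hα)).1.1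
    have hmem' : ∀ c, ε ≤ c → (c ∈ C δ ↔ c ∈ C α ∧ c < β) := by
      intro c hc
      have := Set.ext_iff.1 hβ c
      simpa [hc.not_gt] using this
    refine ⟨ε, hε, fun c hc hcδ => ⟨fun h => ((hmem' c hc).1 h).1, fun h => (hmem' c hc).2 ⟨h, ?_⟩⟩⟩
    obtain ⟨e, he, h1, _⟩ := (hcofl δ (hδ.trans hα) hlδ).2 c hcδ
    exact h1.trans ((hmem' e (hc.trans h1.le)).1 he).2
  · have hst := hg (fun _ => B ∩ Iio κ.ord) (fun _ _ => ⟨inter_subset_right, fun x => by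
      obtain ⟨e, he, h1, h2⟩ := hB x.1 x.2
      exact ⟨⟨e, h2⟩, ⟨he, h2⟩, h1.le⟩⟩) _ (mem_singleton _)
    obtain ⟨γ, ⟨_, hγ⟩, hγκ, hPγ, h0, hlim⟩ :=
      hst.exists_onClub hreg hunc (hP.and (OnClub.limit hreg))
    have hl : Order.IsSuccLimit γ := isSuccLimit_iff.2 ⟨h0.ne',
      Order.isSuccPrelimit_iff_succ_lt.2 hlim⟩
    refine ⟨γ, hγκ, hPγ, h0, fun ξ hξ => ?_⟩
    have hs := hγ 0 (by simp [h0])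
    have hsub : nacc (C γ) ∩ (B ∩ Iio κ.ord) ⊆ Iio γ := fun x hx => (hC γ hγκ).1.1 hx.1.1
    have h2 : IsLimitOf (nacc (C γ) ∩ (B ∩ Iio κ.ord)) γ := by
      rw [isLimitOf_iff_sSup, inter_eq_left.2 hsub]
      exact ⟨h0, hs⟩
    obtain ⟨β, ⟨hβ, hβB⟩, h3, h4⟩ := h2.2 ξ hξ
    rw [hLlim γ hl hγκ]
    refine ⟨β, hβ.1, hβB.1, h3, sSup (C γ ∩ Iio β), lt_of_le_of_ne (csSup_le' fun x hx => hx.2.le)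
      fun heq => hβ.2 ⟨hβ.1, heq, (bot_le.trans_lt h3)⟩, fun c hc hcβ => ?_⟩
    exact le_csSup ⟨β, fun x hx => hx.2.le⟩ ⟨hc, hcβ⟩

/-- This reduces both alternatives of the theorem to coherence modulo bounded sets. An accumulation
point `β` is a limit, so `sSup (C β) = β > 0` and `ε = 0` serves. -/
theorem ProxyMinus.initSegStar {𝒮 : Set (Set Ordinal.{u})} {θ : Cardinal.{u}}
    (h : ProxyMinus κ InitSeg θ 𝒮) : ProxyMinus κ InitSegStar θ 𝒮 := by
  obtain ⟨C, hC, hcoh, hg⟩ := h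
  refine ⟨C, hC, fun α hα β hβ hacc => ?_, hg⟩
  refine (hcoh α hα β hβ hacc).initSegStar ?_
  have hl : Order.IsSuccLimit β := by
    have := isLimitOf_iff_sSup.2 ⟨hacc.2.2, hacc.2.1⟩
    refine isSuccLimit_iff.2 ⟨this.1.ne', ?_⟩
    rw [Order.isSuccPrelimit_iff_succ_lt]
    intro ξ hξ
    obtain ⟨e, _, h1, h2⟩ := this.2 ξ hξ
    exact (Order.succ_le_iff.2 h1).trans_lt h2
  rw [(hC β (hβ.trans hα)).2, hl.sSup_Iio]
  exact hl.bot_lt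

variable {C : Ordinal.{u} → Set Ordinal.{u}}

/-- If the ladder has points between `ξ` and `γ`, their supremum is below `γ`, and closedness puts
it into the ladder. -/
theorem IsLadder.exists_pred {α γ ξ : Ordinal.{u}} (hC : IsLadder κ C) (hα : α < κ.ord)
    (hγα : γ ≤ α) (hξ : ξ < γ) (hlim : ¬ IsLimitOf (C α) γ) :
    ∃ ρ, ξ ≤ ρ ∧ ρ < γ ∧ (ρ = ξ ∨ ρ ∈ C α) ∧ ∀ c ∈ C α, c < γ → c ≤ ρ := by
  by_cases hne : ∃ c ∈ C α, ξ < c ∧ c < γ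
  · obtain ⟨c₀, hc₀, hξ₀, hγ₀⟩ := hne
    have h0 : 0 < γ := bot_le.trans_lt hξ
    have hle : sSup (C α ∩ Iio γ) ≤ γ := csSup_le' fun x hx => hx.2.le
    have hlt : sSup (C α ∩ Iio γ) < γ :=
      lt_of_le_of_ne hle fun h => hlim (isLimitOf_iff_sSup.2 ⟨h0, h⟩)
    have hle' : ∀ c ∈ C α, c < γ → c ≤ sSup (C α ∩ Iio γ) := fun c hc hcγ =>
      le_csSup ⟨γ, fun x hx => hx.2.le⟩ ⟨hc, hcγ⟩
    refine ⟨_, hξ₀.le.trans (hle' _ hc₀ hγ₀), hlt, Or.inr ?_, hle'⟩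
    by_contra hmem
    refine hmem (hC.closed α hα _ (hlt.trans_le hγα) ⟨?_, fun x hx => ?_⟩)
    · exact (bot_le.trans_lt hξ₀).trans_le (hle' _ hc₀ hγ₀)
    · obtain ⟨e, he, h1⟩ := exists_lt_of_lt_csSup (s := C α ∩ Iio γ) ⟨c₀, hc₀, hγ₀⟩ hx
      exact ⟨e, he.1, h1, lt_of_le_of_ne (hle' _ he.1 he.2) fun h => hmem (h ▸ he.1)⟩
  · push Not at hne
    refine ⟨ξ, le_rfl, hξ, Or.inl rfl, fun c hc hcγ => ?_⟩
    by_contra h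
    exact absurd hcγ (not_lt.2 (hne c hc (not_le.1 h)))

/-! ### Tasks: the demands met when climbing along ladders. -/

/-- `β` is a point of the ladder `C α` above `ξ`, and `ρ` is its predecessor in `C α ∪ {ξ}`. -/
def Step (C : Ordinal.{u} → Set Ordinal.{u}) (α ξ ρ β : Ordinal.{u}) : Prop :=
  β ∈ C α ∧ ξ ≤ ρ ∧ ρ < β ∧ (ρ = ξ ∨ ρ ∈ C α) ∧ ∀ c ∈ C α, c < β → c ≤ ρ

/-- The iterates of `h` starting at `ρ` are strictly increasing and bounded by `β`. -/
def Climbs (h : Ordinal.{u} → Ordinal.{u}) (ρ β : Ordinal.{u}) : Prop :=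
  ∀ j, h^[j] ρ < h^[j + 1] ρ ∧ h^[j + 1] ρ < β

/-- The intervals into which the interval from `ρ` to `β` is split. -/
def Segment (g : Ordinal.{u} → Ordinal.{u} → Ordinal.{u}) (k : ℕ) (ρ β ξ α : Ordinal.{u}) : Prop :=
  (Climbs (g β) ρ β ∧ ((∃ j < k, ξ = (g β)^[j] ρ ∧ α = (g β)^[j + 1] ρ) ∨
    (ξ = (g β)^[k + 1] ρ ∧ α = ⨆ j, (g β)^[j] ρ) ∨
    (ξ = ⨆ j, (g β)^[j] ρ) ∧ α = β ∧ ξ < β)) ∨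
  (¬ Climbs (g β) ρ β ∧ ξ = ρ ∧ α = β)

/-- The triples `(η, ζ, b)` such that the demand guessed at `b` has to be met between `η` and `ζ`
on the way from level `ρ` to level `β`. -/
inductive StepTask (C : Ordinal.{u} → Set Ordinal.{u}) (g : Ordinal.{u} → Ordinal.{u} → Ordinal.{u})
    (k : ℕ) : Ordinal.{u} → Ordinal.{u} → Ordinal.{u} → Ordinal.{u} → Ordinal.{u} → Prop
  | direct {ρ β : Ordinal.{u}} : Climbs (g β) ρ β →
      StepTask C g k ρ β ((g β)^[k] ρ) ((g β)^[k + 1] ρ) β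
  | sub {ρ β ξ α ρ' β' η ζ b : Ordinal.{u}} : Segment g k ρ β ξ α → Step C α ξ ρ' β' →
      StepTask C g k ρ' β' η ζ b → StepTask C g k ρ β η ζ b

/-- The triples `(η, ζ, b)` such that the demand guessed at `b` has to be met between `η` and `ζ`
on the way from level `ξ` to level `α`. -/
def Task (C : Ordinal.{u} → Set Ordinal.{u}) (g : Ordinal.{u} → Ordinal.{u} → Ordinal.{u})
    (k : ℕ) (ξ α η ζ b : Ordinal.{u}) : Prop :=
  ∃ ρ β, Step C α ξ ρ β ∧ StepTask C g k ρ β η ζ b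

variable {g : Ordinal.{u} → Ordinal.{u} → Ordinal.{u}} {k : ℕ}

theorem Climbs.iterate_lt {h : Ordinal.{u} → Ordinal.{u}} {ρ β : Ordinal.{u}} (H : Climbs h ρ β)
    (j : ℕ) : h^[j] ρ < β := (H j).1.trans (H j).2

theorem Climbs.iSup_le {h : Ordinal.{u} → Ordinal.{u}} {ρ β : Ordinal.{u}} (H : Climbs h ρ β) :
    ⨆ j, h^[j] ρ ≤ β := Ordinal.iSup_le fun j => (H.iterate_lt j).le

theorem Climbs.iterate_lt_iSup {h : Ordinal.{u} → Ordinal.{u}} {ρ β : Ordinal.{u}}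
    (H : Climbs h ρ β) (j : ℕ) : h^[j] ρ < ⨆ j, h^[j] ρ :=
  exists_iSup_nat.2 ⟨j + 1, (H j).1⟩

theorem Climbs.strictMono {h : Ordinal.{u} → Ordinal.{u}} {ρ β : Ordinal.{u}} (H : Climbs h ρ β) :
    StrictMono fun j => h^[j] ρ := strictMono_nat_of_lt_succ fun j => (H j).1

theorem Segment.le {ρ β ξ α : Ordinal.{u}} (h : Segment g k ρ β ξ α) : α ≤ β := by
  rcases h with ⟨h, ⟨j, _, _, rfl⟩ | ⟨_, rfl⟩ | ⟨_, rfl, _⟩⟩ | ⟨_, _, rfl⟩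
  · exact (h.iterate_lt _).le
  · exact h.iSup_le
  · exact le_rfl
  · exact le_rfl

theorem StepTask.bounds (hC : ∀ α, ∀ β ∈ C α, β < α) {ρ β η ζ b : Ordinal.{u}}
    (h : StepTask C g k ρ β η ζ b) : η < ζ ∧ ζ < b ∧ b ≤ β := by
  induction h with
  | direct h => exact ⟨(h k).1, (h k).2, le_rfl⟩
  | sub h1 h2 _ ih => exact ⟨ih.1, ih.2.1, ih.2.2.trans ((hC _ _ h2.1).le.trans h1.le)⟩

theorem Task.bounds (hC : ∀ α, ∀ β ∈ C α, β < α) {ξ α η ζ b : Ordinal.{u}}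
    (h : Task C g k ξ α η ζ b) : η < ζ ∧ ζ < b ∧ b < α := by
  obtain ⟨ρ, β, h1, h2⟩ := h
  have := h2.bounds hC
  exact ⟨this.1, this.2.1, this.2.2.trans_lt (hC _ _ h1.1)⟩

/-- Membership of `ξ'` in the ladder keeps it a legitimate predecessor once the start is lowered. -/
theorem Task.mono {ξ ξ' α η ζ b : Ordinal.{u}} (h : Task C g k ξ' α η ζ b) (hle : ξ ≤ ξ')
    (hξ' : ξ' ∈ C α) : Task C g k ξ α η ζ b := by
  obtain ⟨ρ, β, ⟨h1, h2, h3, h4, h5⟩, h6⟩ := h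
  refine ⟨ρ, β, ⟨h1, hle.trans h2, h3, Or.inr ?_, h5⟩, h6⟩
  rcases h4 with rfl | h4
  exacts [hξ', h4]

theorem Segment.task {ρ β ξ α ξ' α' η ζ b : Ordinal.{u}} (hs : Step C α ξ ρ β)
    (h : Segment g k ρ β ξ' α') (ht : Task C g k ξ' α' η ζ b) : Task C g k ξ α η ζ b := by
  obtain ⟨ρ', β', h1, h2⟩ := ht
  exact ⟨ρ, β, hs, .sub h h1 h2⟩

/-- `γ` is a limit of the members of `B` that are successor points of `C γ`. -/
def HitsAt (C : Ordinal.{u} → Set Ordinal.{u}) (B : Set Ordinal.{u}) (γ : Ordinal.{u}) : Prop :=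
  0 < γ ∧ ∀ ξ < γ, ∃ β ∈ C γ, β ∈ B ∧ ξ < β ∧ ∃ ρ < β, ∀ c ∈ C γ, c < β → c ≤ ρ

theorem IsLadder.exists_agree (hC : IsLadder κ C) {α γ : Ordinal.{u}} (hα : α < κ.ord)
    (hγα : γ ≤ α) (h0 : 0 < γ) (h : γ = α ∨ IsLimitOf (C α) γ) :
    ∃ ε < γ, ∀ c, ε ≤ c → c < γ → (c ∈ C γ ↔ c ∈ C α) := by
  rcases hγα.eq_or_lt with rfl | hlt
  · exact ⟨0, h0, fun _ _ _ => Iff.rfl⟩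
  · exact hC.coh α hα γ hlt (h.resolve_left hlt.ne)

/-- There is a task from `ξ` to `α` guessed at a point of `B`. -/
def HasTaskAt (C : Ordinal.{u} → Set Ordinal.{u}) (g : Ordinal.{u} → Ordinal.{u} → Ordinal.{u})
    (B : Set Ordinal.{u}) (k : ℕ) (ξ α : Ordinal.{u}) : Prop :=
  ∃ η b, b ∈ B ∧ Task C g k ξ α η (g b η) b

/-- `C γ` and `C α` agree on a tail below `γ`, so a successor point `β ∈ B` of `C γ` high enough is
a successor point of `C α` too. As `g β` is inflationary below `β`, its iterates climb, and `β`
contributes its direct task for any `k`. -/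
theorem HasTaskAt.of_hitsAt (hC : IsLadder κ C) {B : Set Ordinal.{u}}
    (hB : ∀ β ∈ B, ∀ ξ < β, ξ < g β ξ ∧ g β ξ < β) {γ α ξ : Ordinal.{u}} (hα : α < κ.ord)
    (hγ : HitsAt C B γ) (hγα : γ ≤ α) (h : γ = α ∨ IsLimitOf (C α) γ) (hξ : ξ < γ) :
    HasTaskAt C g B k ξ α := by
  obtain ⟨ε, hε, hag⟩ := hC.exists_agree hα hγα hγ.1 h
  obtain ⟨β, hβ, hβB, hlt, σ, hσ, hmax⟩ := hγ.2 _ (max_lt hξ hε)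
  have hξβ : ξ < β := (le_max_left _ _).trans_lt hlt
  have hεβ : ε < β := (le_max_right _ _).trans_lt hlt
  have hβγ := hC.lt _ _ hβ
  have hnl : ¬ IsLimitOf (C α) β := by
    intro hl
    obtain ⟨c, hc, h1, h2⟩ := hl.2 _ (max_lt hσ hεβ)
    have hc' := (hag c ((le_max_right _ _).trans h1.le) (h2.trans hβγ)).2 hc
    exact absurd ((le_max_left _ _).trans_lt h1) (not_lt.2 (hmax c hc' h2))
  obtain ⟨ρ, h1, h2, h3, h4⟩ := hC.exists_pred hα (hβγ.le.trans hγα) hξβ hnl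
  have hcl : Climbs (g β) ρ β := by
    have : ∀ j, (g β)^[j] ρ < β := by
      intro j
      induction j with
      | zero => exact h2
      | succ j ih => rw [Function.iterate_succ_apply']; exact (hB β hβB _ ih).2
    intro j
    refine ⟨?_, this _⟩
    rw [Function.iterate_succ_apply']
    exact (hB β hβB _ (this j)).1
  refine ⟨(g β)^[k] ρ, β, hβB, ρ, β, ⟨(hag β hεβ.le hβγ).1 hβ, h1, h2, h3, h4⟩, ?_⟩
  have := StepTask.direct (C := C) (k := k) hcl
  rwa [Function.iterate_succ_apply'] at this

/-- Walk down from `α` towards `γ`. If `γ` is not a limit of the ladder, it falls into one of its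
steps and there into some segment, where the induction hypothesis applies. The only obstacle is the
interval between the iterates `k` and `k + 1`, which is reserved for the direct demand and so
carries no others. Taking `k` beyond the iterate that passes `γ` avoids it. -/
theorem HasTaskAt.eventually (hC : IsLadder κ C) {B : Set Ordinal.{u}}
    (hB : ∀ β ∈ B, ∀ ξ < β, ξ < g β ξ ∧ g β ξ < β) {γ : Ordinal.{u}} (hγ : HitsAt C B γ) :
    ∀ α : Ordinal.{u}, α < κ.ord → γ ≤ α → ∀ ξ < γ, ∃ K, ∀ k ≥ K, HasTaskAt C g B k ξ α := by
  intro α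
  induction α using WellFoundedLT.induction with
  | _ α ih =>
    intro hα hγα ξ hξ
    by_cases h : γ = α ∨ IsLimitOf (C α) γ
    · exact ⟨0, fun k _ => .of_hitsAt hC hB hα hγ hγα h hξ⟩
    push Not at h
    obtain ⟨ρ, h1, h2, h3, h4⟩ := hC.exists_pred hα hγα hξ h.2
    have hne : {c | c ∈ C α ∧ γ ≤ c}.Nonempty := hC.cof α hα γ (lt_of_le_of_ne hγα h.1)
    obtain ⟨β, ⟨hβ, hγβ⟩, hmin⟩ := wellFounded_lt.has_min _ hne
    have hβα := hC.lt _ _ hβ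
    have hs : Step C α ξ ρ β := by
      refine ⟨hβ, h1, h2.trans_le hγβ, h3, fun c hc hcβ => ?_⟩
      by_contra hcon
      refine hmin c ⟨hc, ?_⟩ hcβ
      by_contra hcon'
      exact hcon (h4 c hc (not_le.1 hcon'))
    have lift : ∀ k ξ' α', Segment g k ρ β ξ' α' → HasTaskAt C g B k ξ' α' →
        HasTaskAt C g B k ξ α := by
      rintro k ξ' α' hseg ⟨η, b, hb, ht⟩
      exact ⟨η, b, hb, hseg.task hs ht⟩
    by_cases hcl : Climbs (g β) ρ β
    · by_cases hex : ∃ j, γ ≤ (g β)^[j] ρ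
      · classical
        obtain ⟨j, hj, hjm⟩ : ∃ j, γ ≤ (g β)^[j + 1] ρ ∧ (g β)^[j] ρ < γ := by
          have h0 : Nat.find hex ≠ 0 := fun h0 => by
            have := Nat.find_spec hex
            rw [h0] at this
            exact absurd h2 (not_lt.2 this)
          obtain ⟨j, hj⟩ := Nat.exists_eq_succ_of_ne_zero h0
          have hspec := Nat.find_spec hex
          rw [hj] at hspec
          exact ⟨j, hspec, not_le.1 (Nat.find_min hex (m := j) (by omega))⟩
        have hlt := (hcl j).2.trans hβα
        obtain ⟨K, hK⟩ := ih _ hlt (hlt.trans hα) hj _ hjm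
        refine ⟨max K (j + 1), fun k hk => lift k _ _ (Or.inl ⟨hcl, Or.inl ⟨j, ?_, rfl, rfl⟩⟩)
          (hK k ((le_max_left _ _).trans hk))⟩
        exact (le_max_right K (j + 1)).trans hk
      · push Not at hex
        have hle : ⨆ j, (g β)^[j] ρ ≤ γ := Ordinal.iSup_le fun j => (hex j).le
        rcases hle.eq_or_lt with heq | hlt
        -- The iterates converge to `γ` itself, which is then the top of the segment starting at
        -- iterate `k + 1`.
        · refine ⟨0, fun k _ => lift k _ _ (Or.inl ⟨hcl, Or.inr (Or.inl ⟨rfl, rfl⟩)⟩) ?_⟩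
          rw [heq]
          exact .of_hitsAt hC hB (hγα.trans_lt hα) hγ le_rfl (Or.inl rfl) (hex _)
        · obtain ⟨K, hK⟩ := ih β hβα (hβα.trans hα) hγβ _ hlt
          exact ⟨K, fun k hk => lift k _ _
            (Or.inl ⟨hcl, Or.inr (Or.inr ⟨rfl, rfl, hlt.trans_le hγβ⟩)⟩) (hK k hk)⟩
    · obtain ⟨K, hK⟩ := ih β hβα (hβα.trans hα) hγβ ρ h2
      exact ⟨K, fun k hk => lift k _ _ (Or.inr ⟨hcl, rfl, rfl⟩) (hK k hk)⟩

/-- No sequence of length `ω` is cofinal in `δ`, and `δ ≠ 0`. -/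
def UncountableCof (δ : Ordinal.{u}) : Prop :=
  0 < δ ∧ ¬ ∃ c : ℕ → Ordinal.{u}, (∀ n, c n < δ) ∧ ∀ ξ < δ, ∃ n, ξ ≤ c n

/-- If every `k` failed at some ladder point `c k`, uncountable cofinality would bound all `c k`
below `α`. A hitting point `γ` above that bound gives a task for all large `k`, and this task also
counts from `c k`. -/
theorem HasTaskAt.exists_uniform (hC : IsLadder κ C) {B : Set Ordinal.{u}}
    (hB : ∀ β ∈ B, ∀ ξ < β, ξ < g β ξ ∧ g β ξ < β) {α : Ordinal.{u}} (hα : α < κ.ord)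
    (hu : UncountableCof α) (hl : IsLimitOf {γ | HitsAt C B γ} α) :
    ∃ k, ∀ ξ ∈ C α, HasTaskAt C g B k ξ α := by
  by_contra hcon
  push Not at hcon
  choose c hc hnt using hcon
  refine hu.2 ⟨c, fun n => hC.lt _ _ (hc n), fun ξ hξ => ?_⟩
  by_contra hcon
  push Not at hcon
  obtain ⟨ξ', hξ', hle⟩ := hC.cof α hα ξ hξ
  obtain ⟨γ, hγ, h1, h2⟩ := hl.2 ξ' (hC.lt _ _ hξ')
  obtain ⟨K, hK⟩ := HasTaskAt.eventually hC hB hγ α hα h2.le ξ' h1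
  obtain ⟨η, b, hb, ht⟩ := hK K le_rfl
  exact hnt K ⟨η, b, hb, ht.mono ((hcon K).le.trans hle) hξ'⟩

/-! ### The tree and its omitted branches. -/

/-- The level `α` of the tree of all sequences bounded by `max ω ·` that do not extend any of the
omitted branches `om δ`. Only the values of `f` below `α` matter. -/
def Level (om : Ordinal.{u} → Option (Ordinal.{u} → Ordinal.{u})) (α : Ordinal.{u})
    (f : Ordinal.{u} → Ordinal.{u}) : Prop :=
  (∀ i < α, f i < max ω i) ∧ ∀ δ ≤ α, ∀ b, om δ = some b → ∃ i < δ, f i ≠ b i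

/-- The demand `(η, ζ, b)`: if some extension of `f ↾ η` below level `ζ` is, according to the guess
`D b`, in the dense set, then so is a restriction of `f` to some level below `ζ`. -/
def Meets (T D : Ordinal.{u} → (Ordinal.{u} → Ordinal.{u}) → Prop) (η ζ : Ordinal.{u})
    (f : Ordinal.{u} → Ordinal.{u}) : Prop :=
  (∃ ν < ζ, ∃ z, η ≤ ν ∧ T ν z ∧ (∀ i < η, z i = f i) ∧ D ν z) → ∃ ν < ζ, D ν f

/-- The branch `f` of length `δ` meets all demands above some point of the ladder at `δ`. -/
def IsCanonical (C : Ordinal.{u} → Set Ordinal.{u}) (g : Ordinal.{u} → Ordinal.{u} → Ordinal.{u})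
    (D : Ordinal.{u} → Ordinal.{u} → (Ordinal.{u} → Ordinal.{u}) → Prop) (k : ℕ)
    (T : Ordinal.{u} → (Ordinal.{u} → Ordinal.{u}) → Prop) (δ : Ordinal.{u})
    (f : Ordinal.{u} → Ordinal.{u}) : Prop :=
  ∃ ξ ∈ C δ, ∀ η ζ b, Task C g k ξ δ η ζ b → Meets T (D b) η ζ f

/-- `b` may be omitted at level `δ`. -/
def Omittable (C : Ordinal.{u} → Set Ordinal.{u}) (g : Ordinal.{u} → Ordinal.{u} → Ordinal.{u})
    (D : Ordinal.{u} → Ordinal.{u} → (Ordinal.{u} → Ordinal.{u}) → Prop) (k : ℕ)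
    (T : Ordinal.{u} → (Ordinal.{u} → Ordinal.{u}) → Prop) (δ : Ordinal.{u})
    (b : Ordinal.{u} → Ordinal.{u}) : Prop :=
  UncountableCof δ ∧ (∀ β < δ, T β b) ∧ ¬ IsCanonical C g D k T δ b

open Classical in
/-- The branch to be omitted at level `δ`. -/
noncomputable def omitted (C : Ordinal.{u} → Set Ordinal.{u})
    (g : Ordinal.{u} → Ordinal.{u} → Ordinal.{u})
    (D : Ordinal.{u} → Ordinal.{u} → (Ordinal.{u} → Ordinal.{u}) → Prop) (k : ℕ) :
    Ordinal.{u} → Option (Ordinal.{u} → Ordinal.{u}) :=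
  WellFoundedLT.fix fun δ prev =>
    if h : ∃ b, Omittable C g D k (Level fun β => if hβ : β < δ then prev β hβ else none) δ b
    then some h.choose else none

/-- The tree determined by the omitted branches. -/
def OmTree (C : Ordinal.{u} → Set Ordinal.{u}) (g : Ordinal.{u} → Ordinal.{u} → Ordinal.{u})
    (D : Ordinal.{u} → Ordinal.{u} → (Ordinal.{u} → Ordinal.{u}) → Prop) (k : ℕ) :
    Ordinal.{u} → (Ordinal.{u} → Ordinal.{u}) → Prop :=
  Level (omitted C g D k)

variable {D : Ordinal.{u} → Ordinal.{u} → (Ordinal.{u} → Ordinal.{u}) → Prop}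

theorem Level.congr_om {om om' : Ordinal.{u} → Option (Ordinal.{u} → Ordinal.{u})}
    {α : Ordinal.{u}} (h : ∀ δ ≤ α, om δ = om' δ) {f : Ordinal.{u} → Ordinal.{u}}
    (hf : Level om α f) : Level om' α f :=
  ⟨hf.1, fun δ hδ b hb => hf.2 δ hδ b (by rw [h δ hδ, hb])⟩

theorem Level.congr {om : Ordinal.{u} → Option (Ordinal.{u} → Ordinal.{u})}
    {α : Ordinal.{u}} {f f' : Ordinal.{u} → Ordinal.{u}} (hf : Level om α f)
    (h : ∀ i < α, f' i = f i) : Level om α f' := by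
  refine ⟨fun i hi => h i hi ▸ hf.1 i hi, fun δ hδ b hb => ?_⟩
  obtain ⟨i, hi, hne⟩ := hf.2 δ hδ b hb
  exact ⟨i, hi, by rwa [h i (hi.trans_le hδ)]⟩

theorem Level.mono {om : Ordinal.{u} → Option (Ordinal.{u} → Ordinal.{u})}
    {α β : Ordinal.{u}} {f : Ordinal.{u} → Ordinal.{u}} (hf : Level om α f) (h : β ≤ α) :
    Level om β f :=
  ⟨fun i hi => hf.1 i (hi.trans_le h), fun δ hδ => hf.2 δ (hδ.trans h)⟩

/-- `D ν z` depends only on the values of `z` below `ν`. -/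
def IsLocal (D : Ordinal.{u} → (Ordinal.{u} → Ordinal.{u}) → Prop) : Prop :=
  ∀ ν z z', (∀ i < ν, z' i = z i) → D ν z → D ν z'

theorem Meets.congr {T D : Ordinal.{u} → (Ordinal.{u} → Ordinal.{u}) → Prop} (hD : IsLocal D)
    {η ζ : Ordinal.{u}} (hηζ : η ≤ ζ) {f f' : Ordinal.{u} → Ordinal.{u}}
    (h : ∀ i < ζ, f' i = f i) (hf : Meets T D η ζ f) : Meets T D η ζ f' := by
  rintro ⟨ν, hν, z, h1, h2, h3, h4⟩
  obtain ⟨ν', hν', h5⟩ := hf ⟨ν, hν, z, h1, h2, fun i hi =>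
    (h3 i hi).trans (h i (hi.trans_le hηζ)), h4⟩
  exact ⟨ν', hν', hD _ _ _ (fun i hi => h i (hi.trans hν')) h5⟩

theorem Meets.congr_tree {T T' D : Ordinal.{u} → (Ordinal.{u} → Ordinal.{u}) → Prop}
    {η ζ : Ordinal.{u}} {f : Ordinal.{u} → Ordinal.{u}}
    (h : ∀ ν < ζ, ∀ z, T' ν z → T ν z) (hf : Meets T D η ζ f) : Meets T' D η ζ f := by
  rintro ⟨ν, hν, z, h1, h2, h3, h4⟩
  exact hf ⟨ν, hν, z, h1, h ν hν z h2, h3, h4⟩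

theorem IsCanonical.congr (hC : ∀ α, ∀ β ∈ C α, β < α) (hD : ∀ b, IsLocal (D b))
    {T T' : Ordinal.{u} → (Ordinal.{u} → Ordinal.{u}) → Prop} {δ : Ordinal.{u}}
    {f f' : Ordinal.{u} → Ordinal.{u}} (hT : ∀ ν < δ, ∀ z, T' ν z → T ν z)
    (h : ∀ i < δ, f' i = f i) (hf : IsCanonical C g D k T δ f) : IsCanonical C g D k T' δ f' := by
  obtain ⟨ξ, hξ, hf⟩ := hf
  refine ⟨ξ, hξ, fun η ζ b ht => ?_⟩
  obtain ⟨h1, h2, h3⟩ := ht.bounds hC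
  have h4 := h2.trans h3
  exact ((hf η ζ b ht).congr (hD b) h1.le fun i hi => h i (hi.trans h4)).congr_tree
    fun ν hν => hT ν (hν.trans h4)

-- All tasks at `δ` lie below `δ`, so being omittable depends only on the levels below `δ`. Hence
-- the truncated data available in the recursion can be replaced by the finished tree.
open Classical in
theorem omittable_iff (hC : ∀ α, ∀ β ∈ C α, β < α) (hD : ∀ b, IsLocal (D b)) (δ : Ordinal.{u})
    (b : Ordinal.{u} → Ordinal.{u}) :
    Omittable C g D k (Level fun β => if _ : β < δ then omitted C g D k β else none) δ b ↔
      Omittable C g D k (OmTree C g D k) δ b := by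
  have h1 : ∀ ν < δ, ∀ z, (Level fun β => if _ : β < δ then omitted C g D k β else none) ν z ↔
      OmTree C g D k ν z := fun ν hν z =>
    ⟨fun h => h.congr_om fun β hβ => by simp [hβ.trans_lt hν],
      fun h => h.congr_om fun β hβ => by simp [hβ.trans_lt hν]⟩
  refine and_congr_right fun _ => and_congr (forall₂_congr fun β hβ => h1 β hβ b)
    (not_congr ⟨?_, ?_⟩)
  · exact IsCanonical.congr hC hD (fun ν hν z => (h1 ν hν z).2) fun _ _ => rfl
  · exact IsCanonical.congr hC hD (fun ν hν z => (h1 ν hν z).1) fun _ _ => rfl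

theorem omitted_of_some (hC : ∀ α, ∀ β ∈ C α, β < α) (hD : ∀ b, IsLocal (D b)) {δ : Ordinal.{u}}
    {b : Ordinal.{u} → Ordinal.{u}} (h : omitted C g D k δ = some b) :
    Omittable C g D k (OmTree C g D k) δ b := by
  classical
  rw [omitted, WellFoundedLT.fix_eq] at h
  split_ifs at h with hex
  obtain rfl := Option.some.inj h
  exact (omittable_iff hC hD δ _).1 hex.choose_spec

theorem Omittable.exists_omitted (hC : ∀ α, ∀ β ∈ C α, β < α) (hD : ∀ b, IsLocal (D b))
    {δ : Ordinal.{u}} {b : Ordinal.{u} → Ordinal.{u}}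
    (h : Omittable C g D k (OmTree C g D k) δ b) : ∃ b', omitted C g D k δ = some b' := by
  classical
  have hex := (omittable_iff hC hD δ b).2 h
  rw [omitted, WellFoundedLT.fix_eq]
  exact ⟨_, dif_pos ⟨b, hex⟩⟩

theorem not_uncountableCof_succ (β : Ordinal.{u}) : ¬ UncountableCof (Order.succ β) :=
  fun h => h.2 ⟨fun _ => β, fun _ => Order.lt_succ β, fun _ hξ => ⟨0, Order.lt_succ_iff.1 hξ⟩⟩

/-- Nothing is omitted at successor levels, as they do not have uncountable cofinality. -/
theorem OmTree.snoc (hC : ∀ α, ∀ β ∈ C α, β < α) (hD : ∀ b, IsLocal (D b)) {α : Ordinal.{u}}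
    {f f' : Ordinal.{u} → Ordinal.{u}} (hf : OmTree C g D k α f) (h : ∀ i < α, f' i = f i)
    (hα : f' α < max ω α) : OmTree C g D k (Order.succ α) f' := by
  have hf' := Level.congr hf h
  refine ⟨fun i hi => ?_, fun δ hδ b hb => ?_⟩
  · rcases (Order.lt_succ_iff.1 hi).eq_or_lt with rfl | hi
    exacts [hα, hf'.1 i hi]
  · rcases hδ.eq_or_lt with rfl | hδ
    · exact absurd (omitted_of_some hC hD hb).1 (not_uncountableCof_succ α)
    · exact hf'.2 δ (Order.lt_succ_iff.1 hδ) b hb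

theorem OmTree.zero (hC : ∀ α, ∀ β ∈ C α, β < α) (hD : ∀ b, IsLocal (D b))
    (f : Ordinal.{u} → Ordinal.{u}) : OmTree C g D k 0 f := by
  refine ⟨fun i hi => absurd hi (by simp), fun δ hδ b hb => ?_⟩
  obtain rfl : δ = 0 := by simpa using hδ
  exact absurd (omitted_of_some hC hD hb).1.1 (lt_irrefl _)

/-! ### Extending nodes along ladders. -/

/-- Every node below level `α` extends to level `α` so that all demands are met on the way. -/
def Extendible (C : Ordinal.{u} → Set Ordinal.{u}) (g : Ordinal.{u} → Ordinal.{u} → Ordinal.{u})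
    (D : Ordinal.{u} → Ordinal.{u} → (Ordinal.{u} → Ordinal.{u}) → Prop) (k : ℕ)
    (α : Ordinal.{u}) : Prop :=
  ∀ ξ < α, ∀ x, OmTree C g D k ξ x → ∃ f, OmTree C g D k α f ∧ (∀ i < ξ, f i = x i) ∧
    ∀ η ζ b, Task C g k ξ α η ζ b → Meets (OmTree C g D k) (D b) η ζ f

/-- One step of the ladder. The segments are disjoint intervals, crossed in order by means of
extendibility at their tops. A demand met once stays met, since it concerns only values below the
top of its interval. -/
theorem Extendible.exists_climb (hC : ∀ α, ∀ β ∈ C α, β < α) (hD : ∀ b, IsLocal (D b))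
    {ρ β : Ordinal.{u}} (hβ : ∀ α ≤ β, Extendible C g D k α) (hρ : ρ < β)
    {x : Ordinal.{u} → Ordinal.{u}} (hx : OmTree C g D k ρ x) :
    ∃ f, OmTree C g D k β f ∧ (∀ i < ρ, f i = x i) ∧
      ∀ η ζ b, StepTask C g k ρ β η ζ b → Meets (OmTree C g D k) (D b) η ζ f := by
  by_cases hcl : Climbs (g β) ρ β
  swap
  · obtain ⟨f, h1, h2, h3⟩ := hβ β le_rfl ρ hρ x hx
    refine ⟨f, h1, h2, fun η ζ b ht => ?_⟩
    cases ht with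
    | direct h => exact absurd h hcl
    | sub h h' h'' =>
      rcases h with h | ⟨_, rfl, rfl⟩
      · exact absurd h.1 hcl
      · exact h3 _ _ _ ⟨_, _, h', h''⟩
  have hmono := hcl.strictMono
  have chain : ∀ j ≤ k, ∃ f, OmTree C g D k ((g β)^[j] ρ) f ∧ (∀ i < ρ, f i = x i) ∧
      ∀ j' < j, ∀ η ζ b, Task C g k ((g β)^[j'] ρ) ((g β)^[j' + 1] ρ) η ζ b →
        Meets (OmTree C g D k) (D b) η ζ f := by
    intro j
    induction j with
    | zero => exact fun _ => ⟨x, hx, fun _ _ => rfl, fun j' h => absurd h (by omega)⟩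
    | succ j ih =>
      intro hj
      obtain ⟨f, h1, h2, h3⟩ := ih (by omega)
      obtain ⟨f', h1', h2', h3'⟩ := hβ _ (hcl.iterate_lt (j + 1)).le _ (hcl j).1 f h1
      refine ⟨f', h1', fun i hi => (h2' i (hi.trans_le (hmono.monotone (Nat.zero_le j)))).trans
        (h2 i hi), fun j' hj' η ζ b ht => ?_⟩
      rcases (Nat.lt_succ_iff.1 hj').eq_or_lt with rfl | hj'
      · exact h3' η ζ b ht
      · obtain ⟨b1, b2, b3⟩ := ht.bounds hC
        exact (h3 j' hj' η ζ b ht).congr (hD b) b1.le fun i hi =>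
          h2' i (hi.trans (b2.trans (b3.trans_le (hmono.monotone hj'))))
  obtain ⟨f₀, hf₀, hx₀, ht₀⟩ := chain k le_rfl
  obtain ⟨f₁, hf₁, hx₁, ht₁⟩ : ∃ f, OmTree C g D k ((g β)^[k + 1] ρ) f ∧
      (∀ i < (g β)^[k] ρ, f i = f₀ i) ∧
      Meets (OmTree C g D k) (D β) ((g β)^[k] ρ) ((g β)^[k + 1] ρ) f := by
    have hext := hβ _ (hcl.iterate_lt (k + 1)).le
    -- The direct demand: pass through a node of the guessed set if there is one above `f₀` in this
    -- interval. Otherwise the demand is void.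
    by_cases hex : ∃ ν < (g β)^[k + 1] ρ, ∃ z, (g β)^[k] ρ ≤ ν ∧ OmTree C g D k ν z ∧
        (∀ i < (g β)^[k] ρ, z i = f₀ i) ∧ D β ν z
    · obtain ⟨ν, hν, z, h1, h2, h3, h4⟩ := hex
      obtain ⟨f, h5, h6, _⟩ := hext ν hν z h2
      exact ⟨f, h5, fun i hi => (h6 i (hi.trans_le h1)).trans (h3 i hi), fun _ =>
        ⟨ν, hν, hD _ _ _ _ h6 h4⟩⟩
    · obtain ⟨f, h5, h6, _⟩ := hext _ (hcl k).1 f₀ hf₀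
      refine ⟨f, h5, h6, fun ⟨ν, hν, z, h1, h2, h3, h4⟩ => absurd ⟨ν, hν, z, h1, h2, ?_, h4⟩ hex⟩
      exact fun i hi => (h3 i hi).trans (h6 i hi)
  have hω := hcl.iterate_lt_iSup (k + 1)
  obtain ⟨f₂, hf₂, hx₂, ht₂⟩ := hβ _ hcl.iSup_le _ hω f₁ hf₁
  obtain ⟨f₃, hf₃, hx₃, ht₃⟩ : ∃ f, OmTree C g D k β f ∧
      (∀ i < ⨆ j, (g β)^[j] ρ, f i = f₂ i) ∧ ((⨆ j, (g β)^[j] ρ) < β →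
        ∀ η ζ b, Task C g k (⨆ j, (g β)^[j] ρ) β η ζ b →
          Meets (OmTree C g D k) (D b) η ζ f) := by
    rcases hcl.iSup_le.eq_or_lt with heq | hlt
    · rw [heq] at hf₂ ⊢
      exact ⟨f₂, hf₂, fun _ _ => rfl, fun h => absurd h (lt_irrefl _)⟩
    · obtain ⟨f, h1, h2, h3⟩ := hβ β le_rfl _ hlt f₂ hf₂
      exact ⟨f, h1, h2, fun _ => h3⟩
  have e₂ : ∀ i < (g β)^[k + 1] ρ, f₃ i = f₁ i := fun i hi =>
    (hx₃ i (hi.trans hω)).trans (hx₂ i hi)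
  have e₁ : ∀ i < (g β)^[k] ρ, f₃ i = f₀ i := fun i hi =>
    (e₂ i (hi.trans (hcl k).1)).trans (hx₁ i hi)
  refine ⟨f₃, hf₃, fun i hi => (e₁ i (hi.trans_le (hmono.monotone (Nat.zero_le k)))).trans
    (hx₀ i hi), fun η ζ b ht => ?_⟩
  cases ht with
  | direct h => exact ht₁.congr (hD _) (hcl k).1.le e₂
  | sub h h' h'' =>
    have ht : Task C g k _ _ η ζ b := ⟨_, _, h', h''⟩
    obtain ⟨b1, b2, b3⟩ := ht.bounds hC
    rcases h with ⟨_, ⟨j, hj, rfl, rfl⟩ | ⟨rfl, rfl⟩ | ⟨rfl, rfl, hlt⟩⟩ | h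
    · exact (ht₀ j hj η ζ b ht).congr (hD b) b1.le fun i hi =>
        e₁ i (hi.trans (b2.trans (b3.trans_le (hmono.monotone hj))))
    · exact (ht₂ η ζ b ht).congr (hD b) b1.le fun i hi => hx₃ i (hi.trans (b2.trans b3))
    · exact ht₃ hlt η ζ b ht
    · exact absurd hcl h.1

/-- `f` is a node at level `δ` extending `x ↾ ξ` and meeting all demands for the steps of the
ladder at `α` between `ξ` and `δ`. -/
structure IsPartialClimb (C : Ordinal.{u} → Set Ordinal.{u})
    (g : Ordinal.{u} → Ordinal.{u} → Ordinal.{u})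
    (D : Ordinal.{u} → Ordinal.{u} → (Ordinal.{u} → Ordinal.{u}) → Prop) (k : ℕ)
    (ξ α : Ordinal.{u}) (x : Ordinal.{u} → Ordinal.{u}) (δ : Ordinal.{u})
    (f : Ordinal.{u} → Ordinal.{u}) : Prop where
  le : ξ ≤ δ
  le' : δ ≤ α
  mem : δ = ξ ∨ δ ∈ C α ∨ δ = α
  tree : OmTree C g D k δ f
  ext : ∀ i < ξ, f i = x i
  meets : ∀ ρ β, Step C α ξ ρ β → β ≤ δ → ∀ η ζ b, StepTask C g k ρ β η ζ b →
    Meets (OmTree C g D k) (D b) η ζ f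

/-- The point where normality could fail. Without a top element, the union of the chain reaches a
limit `δ` of `C α`, and it must be shown not to be the branch omitted there. -/
theorem IsPartialClimb.exists_ub (hC : IsLadder κ C) (hD : ∀ b, IsLocal (D b))
    {ξ α : Ordinal.{u}} (hα : α < κ.ord) {x : Ordinal.{u} → Ordinal.{u}}
    {c : Set (Ordinal.{u} × (Ordinal.{u} → Ordinal.{u}))} (hne : c.Nonempty)
    (hc : ∀ p ∈ c, IsPartialClimb C g D k ξ α x p.1 p.2)
    (hch : ∀ p ∈ c, ∀ q ∈ c, p.1 ≤ q.1 → ∀ i < p.1, q.2 i = p.2 i) :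
    ∃ δ f, IsPartialClimb C g D k ξ α x δ f ∧ ∀ p ∈ c, p.1 ≤ δ ∧ ∀ i < p.1, f i = p.2 i := by
  by_cases hmax : ∃ p ∈ c, ∀ q ∈ c, q.1 ≤ p.1
  · obtain ⟨p, hp, hm⟩ := hmax
    exact ⟨p.1, p.2, hc p hp, fun q hq => ⟨hm q hq, hch q hq p hp (hm q hq)⟩⟩
  push Not at hmax
  classical
  have hbdd : BddAbove (Prod.fst '' c) := ⟨α, by rintro _ ⟨p, hp, rfl⟩; exact (hc p hp).le'⟩
  have hne' : (Prod.fst '' c).Nonempty := hne.image _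
  set δ := sSup (Prod.fst '' c) with hδ
  have hlt : ∀ p ∈ c, p.1 < δ := fun p hp => by
    obtain ⟨q, hq, h⟩ := hmax p hp
    exact h.trans_le (le_csSup hbdd ⟨q, hq, rfl⟩)
  have hex : ∀ i < δ, ∃ p ∈ c, i < p.1 := fun i hi => by
    obtain ⟨_, ⟨p, hp, rfl⟩, h⟩ := exists_lt_of_lt_csSup hne' hi
    exact ⟨p, hp, h⟩
  have hδα : δ ≤ α := csSup_le hne' (by rintro _ ⟨p, hp, rfl⟩; exact (hc p hp).le')
  let f : Ordinal.{u} → Ordinal.{u} := fun i => if h : i < δ then (hex i h).choose.2 i else 0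
  have hf : ∀ p ∈ c, ∀ i < p.1, f i = p.2 i := by
    intro p hp i hi
    have hiδ := hi.trans (hlt p hp)
    simp only [f, dif_pos hiδ]
    obtain ⟨h1, h2⟩ := (hex i hiδ).choose_spec
    rcases le_total p.1 (hex i hiδ).choose.1 with h | h
    · exact hch p hp _ h1 h i hi
    · exact (hch _ h1 p hp h i h2).symm
  have hξδ : ξ < δ := by
    obtain ⟨p, hp⟩ := hne
    exact (hc p hp).le.trans_lt (hlt p hp)
  have hlim : IsLimitOf (C α) δ := by
    refine ⟨bot_le.trans_lt hξδ, fun i hi => ?_⟩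
    obtain ⟨p, hp, h⟩ := hex _ (max_lt hi hξδ)
    refine ⟨p.1, ?_, (le_max_left _ _).trans_lt h, hlt p hp⟩
    rcases (hc p hp).mem with h' | h' | h'
    · exact absurd ((le_max_right i ξ).trans_lt h) (by simp [h'])
    · exact h'
    · exact absurd ((hlt p hp).trans_le hδα) (by simp [h'])
  have hmeets : ∀ ρ β, Step C α ξ ρ β → β < δ → ∀ η ζ b, StepTask C g k ρ β η ζ b →
      Meets (OmTree C g D k) (D b) η ζ f := by
    intro ρ β hs hβ η ζ b ht
    obtain ⟨p, hp, hβp⟩ := hex β hβ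
    obtain ⟨b1, b2, b3⟩ := ht.bounds hC.lt
    exact ((hc p hp).meets ρ β hs hβp.le η ζ b ht).congr (hD b) b1.le fun i hi =>
      hf p hp i (hi.trans (b2.trans_le (b3.trans hβp.le)))
  -- Beyond a ladder point `ξ'` past the disagreement of `C δ` with `C α`, every step of `C δ` is a
  -- step of `C α`, whose demands the climb has met.
  have hcan : IsCanonical C g D k (OmTree C g D k) δ f := by
    have hor : δ = α ∨ IsLimitOf (C α) δ := Or.inr hlim
    obtain ⟨ε, hε, hag⟩ := hC.exists_agree hα hδα hlim.1 hor
    obtain ⟨ξ', hξ', h1, h2⟩ := hlim.2 _ (max_lt hε hξδ)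
    have hεξ' : ε ≤ ξ' := (le_max_left _ _).trans h1.le
    refine ⟨ξ', (hag ξ' hεξ' h2).2 hξ', fun η ζ b ⟨ρ, β, ⟨s1, s2, s3, s4, s5⟩, ht⟩ => ?_⟩
    have hβδ := hC.lt _ _ s1
    have hερ := hεξ'.trans s2
    refine hmeets ρ β ⟨(hag β (hερ.trans s3.le) hβδ).1 s1, ?_, s3, Or.inr ?_, fun d hd hdβ => ?_⟩
      hβδ η ζ b ht
    · exact (le_max_right _ _).trans (h1.le.trans s2)
    · rcases s4 with rfl | s4
      exacts [hξ', (hag ρ hερ (s3.trans hβδ)).1 s4]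
    · by_cases hdε : d < ε
      · exact hdε.le.trans hερ
      · exact s5 d ((hag d (not_lt.1 hdε) (hdβ.trans hβδ)).2 hd) hdβ
  refine ⟨δ, f, ⟨hξδ.le, hδα, ?_, ⟨fun i hi => ?_, fun δ' hδ' b hb => ?_⟩, fun i hi => ?_,
    fun ρ β hs hβδ => ?_⟩, fun p hp => ⟨(hlt p hp).le, hf p hp⟩⟩
  · rcases hδα.eq_or_lt with h | h
    · exact Or.inr (Or.inr h)
    · exact Or.inr (Or.inl (hC.closed α hα δ h hlim))
  · obtain ⟨p, hp, h⟩ := hex i hi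
    rw [hf p hp i h]
    exact (hc p hp).tree.1 i h
  · rcases hδ'.eq_or_lt with rfl | hlt'
    · by_contra hcon
      push Not at hcon
      exact (omitted_of_some hC.lt hD hb).2.2
        (hcan.congr hC.lt hD (fun _ _ _ h => h) fun i hi => (hcon i hi).symm)
    · obtain ⟨p, hp, h⟩ := hex _ hlt'
      obtain ⟨i, hi, hne⟩ := (hc p hp).tree.2 δ' h.le b hb
      exact ⟨i, hi, by rwa [hf p hp i (hi.trans h)]⟩
  · obtain ⟨p, hp⟩ := hne
    rw [hf p hp i (hi.trans_le (hc p hp).le)]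
    exact (hc p hp).ext i hi
  · intro η ζ b ht
    -- `δ` is a limit of `C α`, while `β` has a predecessor in it.
    have : β < δ := by
      refine lt_of_le_of_ne hβδ fun h => ?_
      subst h
      obtain ⟨e, he, h1, h2⟩ := hlim.2 ρ hs.2.2.1
      exact absurd h1 (not_lt.2 (hs.2.2.2.2 e he h2))
    exact hmeets ρ β hs this η ζ b ht

/-- Zorn's lemma for partial climbs along `C α`. A maximal one that stops below `α` could be
prolonged to the next ladder point, or by one value if there is none. -/
theorem OmTree.extendible (hC : IsLadder κ C) (hD : ∀ b, IsLocal (D b)) :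
    ∀ α : Ordinal.{u}, α < κ.ord → Extendible C g D k α := by
  intro α
  induction α using WellFoundedLT.induction with
  | _ α ih =>
  intro hα ξ hξ x hx
  have hstart : IsPartialClimb C g D k ξ α x ξ x :=
    ⟨le_rfl, hξ.le, Or.inl rfl, hx, fun _ _ => rfl, fun ρ β hs hβ =>
      absurd (hs.2.1.trans_lt hs.2.2.1) (not_lt.2 hβ)⟩
  let P := {p : Ordinal.{u} × (Ordinal.{u} → Ordinal.{u}) // IsPartialClimb C g D k ξ α x p.1 p.2}
  let r : P → P → Prop := fun p q => p.1.1 ≤ q.1.1 ∧ ∀ i < p.1.1, q.1.2 i = p.1.2 i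
  obtain ⟨⟨⟨δ, f⟩, hf⟩, hm⟩ : ∃ m : P, ∀ a, r m a → r a m := by
    apply exists_maximal_of_chains_bounded (r := r)
    · intro c hc
      rcases c.eq_empty_or_nonempty with rfl | hne
      · exact ⟨⟨(ξ, x), hstart⟩, fun a ha => absurd ha (notMem_empty a)⟩
      · obtain ⟨δ, f, h1, h2⟩ := IsPartialClimb.exists_ub (c := Subtype.val '' c) hC hD hα
          (hne.image _) (by rintro _ ⟨p, _, rfl⟩; exact p.2) (by
            rintro _ ⟨p, hp, rfl⟩ _ ⟨q, hq, rfl⟩ hle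
            by_cases hpq : p = q
            · subst hpq; exact fun _ _ => rfl
            rcases hc hp hq hpq with h | h
            · exact h.2
            · exact fun i hi => (h.2 i (hi.trans_le hle)).symm)
        exact ⟨⟨(δ, f), h1⟩, fun a ha => h2 _ ⟨a, ha, rfl⟩⟩
    · intro a b c hab hbc
      exact ⟨hab.1.trans hbc.1, fun i hi => (hbc.2 i (hi.trans_le hab.1)).trans (hab.2 i hi)⟩
  rcases hf.le'.eq_or_lt with h | hδ
  · obtain rfl : δ = α := h
    exact ⟨f, hf.tree, hf.ext, fun η ζ b ⟨ρ, β, hs, ht⟩ =>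
      hf.meets ρ β hs (hC.lt _ _ hs.1).le η ζ b ht⟩
  exfalso
  have hf1 : ξ ≤ δ := hf.le
  have hmem : δ = ξ ∨ δ ∈ C α := by
    rcases hf.mem with h | h | h
    exacts [Or.inl h, Or.inr h, absurd h hδ.ne]
  have hold : ∀ f' : Ordinal.{u} → Ordinal.{u}, (∀ i < δ, f' i = f i) →
      ∀ ρ β, Step C α ξ ρ β → β ≤ δ → ∀ η ζ b, StepTask C g k ρ β η ζ b →
        Meets (OmTree C g D k) (D b) η ζ f' := by
    intro f' hf' ρ β hs hβ η ζ b ht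
    obtain ⟨b1, b2, b3⟩ := ht.bounds hC.lt
    exact (hf.meets ρ β hs hβ η ζ b ht).congr (hD b) b1.le fun i hi =>
      hf' i (hi.trans (b2.trans_le (b3.trans hβ)))
  by_cases hne : {c | c ∈ C α ∧ δ < c}.Nonempty
  · obtain ⟨β, ⟨hβ, hδβ⟩, hmin⟩ := wellFounded_lt.has_min _ hne
    have hβα := hC.lt _ _ hβ
    have hs : Step C α δ δ β := ⟨hβ, le_rfl, hδβ, Or.inl rfl, fun c hc hcβ =>
      not_lt.1 fun h => hmin c ⟨hc, h⟩ hcβ⟩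
    obtain ⟨f', h1, h2, h3⟩ := Extendible.exists_climb (ρ := δ) (β := β) hC.lt hD
      (fun a ha => ih a (ha.trans_lt hβα) ((ha.trans_lt hβα).trans hα)) hδβ hf.tree
    have hclimb : IsPartialClimb C g D k ξ α x β f' := by
      refine ⟨hf1.trans hδβ.le, hβα.le, Or.inr (Or.inl hβ), h1, fun i hi =>
        (h2 i (hi.trans_le hf1)).trans (hf.ext i hi), fun ρ β' hs' hβ' η ζ b ht => ?_⟩
      by_cases hle : β' ≤ δ
      · exact hold f' h2 ρ β' hs' hle η ζ b ht
      · have heq : β' = β := le_antisymm hβ' (not_lt.1 (hmin β' ⟨hs'.1, not_le.1 hle⟩))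
        subst heq
        -- The new step starts exactly at `δ`, the last point of `C α ∪ {ξ}` below `β`.
        have hρ : ρ = δ := by
          apply le_antisymm
          · rcases hs'.2.2.2.1 with h | h
            · exact h.trans_le hf1
            · exact hs.2.2.2.2 ρ h hs'.2.2.1
          · rcases hmem with h | h
            · exact h.trans_le hs'.2.1
            · exact hs'.2.2.2.2 δ h hδβ
        subst hρ
        exact h3 η ζ b ht
    exact absurd (hm ⟨(β, f'), hclimb⟩ ⟨hδβ.le, h2⟩).1 (not_le.2 hδβ)
  -- A ladder with no point above `δ` is cofinal only if `δ` is the predecessor of `α`.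
  · have hsucc : α = Order.succ δ := by
      apply le_antisymm _ (Order.succ_le_of_lt hδ)
      by_contra hcon
      obtain ⟨β, hβ, h⟩ := hC.cof α hα _ (not_le.1 hcon)
      exact hne ⟨β, hβ, Order.succ_le_iff.1 h⟩
    classical
    have h2 : ∀ i < δ, Function.update f δ 0 i = f i := fun i hi =>
      Function.update_of_ne hi.ne _ _
    have h1 : OmTree C g D k α (Function.update f δ 0) := by
      rw [hsucc]
      refine OmTree.snoc hC.lt hD hf.tree h2 ?_
      rw [Function.update_self]
      exact omega0_pos.trans_le (le_max_left _ _)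
    have hclimb : IsPartialClimb C g D k ξ α x α (Function.update f δ 0) :=
      ⟨hξ.le, le_rfl, Or.inr (Or.inr rfl), h1, fun i hi =>
        (h2 i (hi.trans_le hf1)).trans (hf.ext i hi), fun ρ β hs _ =>
        hold _ h2 ρ β hs (not_lt.1 fun h => hne ⟨β, hs.1, h⟩)⟩
    exact absurd (hm ⟨(α, _), hclimb⟩ ⟨hδ.le, h2⟩).1 (not_le.2 hδ)

/-! ### Counting and coding nodes. -/

theorem omega0_lt_ord (hunc : Cardinal.aleph0 < κ) : ω < κ.ord := by
  rw [← Cardinal.ord_aleph0]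
  exact Cardinal.ord_lt_ord.2 hunc

theorem mk_sequences_lt (hunc : Cardinal.aleph0 < κ) (hlim : ∀ c < κ, 2 ^ c < κ)
    {ν : Ordinal.{u}} (hν : ν < κ.ord) : #(Iio ν → Iio (max ω ν)) < lift.{u + 1} κ := by
  have hm : (max ω ν).card < κ := lt_ord.1 (max_lt (omega0_lt_ord hunc) hν)
  have hω : Cardinal.aleph0 ≤ (max ω ν).card := by
    rw [← Ordinal.card_omega0]
    exact Ordinal.card_le_card (le_max_left _ _)
  have h : #(Iio ν → Iio (max ω ν)) ≤ lift.{u + 1} (2 ^ (max ω ν).card) := by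
    rw [← Cardinal.power_def, Cardinal.mk_Iio_ordinal, Cardinal.mk_Iio_ordinal,
      ← Cardinal.lift_power, Cardinal.lift_le, ← Cardinal.power_self_eq hω]
    exact Cardinal.power_le_power_left (Cardinal.aleph0_pos.trans_le hω).ne'
      (Ordinal.card_le_card (le_max_right _ _))
  exact h.trans_lt (Cardinal.lift_lt.2 (hlim _ hm))

/-- `z` restricts to a node of the full tree of sequences bounded by `max ω ·`. -/
def IsBoundedBelow (ν : Ordinal.{u}) (z : Ordinal.{u} → Ordinal.{u}) : Prop :=
  ∀ i < ν, z i < max ω i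

/-- The restriction of `z` to `ν`. -/
def IsBoundedBelow.restr {ν : Ordinal.{u}} {z : Ordinal.{u} → Ordinal.{u}}
    (h : IsBoundedBelow ν z) : Iio ν → Iio (max ω ν) :=
  fun i => ⟨z i.1, (h i.1 i.2).trans_le (max_le_max le_rfl (le_of_lt i.2))⟩

/-- Up to agreement below `ν` there are fewer than `κ` pairs of an index and a bounded sequence, so
regularity gives one bound for all of them. `hQ` makes the choice depend on the restriction only. -/
theorem exists_bound_level (hreg : κ.IsRegular) (hunc : Cardinal.aleph0 < κ)
    (hlim : ∀ c < κ, 2 ^ c < κ) {ν : Ordinal.{u}} (hν : ν < κ.ord)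
    {Q : ℕ → (Ordinal.{u} → Ordinal.{u}) → Ordinal.{u} → Prop}
    (hQ : ∀ k z z', (∀ i < ν, z' i = z i) → ∀ b, Q k z b → Q k z' b)
    (h : ∀ k z, IsBoundedBelow ν z → ∃ b < κ.ord, Q k z b) :
    ∃ b < κ.ord, ∀ k z, IsBoundedBelow ν z → ∃ b' < b, Q k z b' := by
  have hι : #(ℕ × (Iio ν → Iio (max ω ν))) < lift.{u + 1} κ := by
    have h2 : Cardinal.aleph0 < lift.{u + 1} κ := by simpa using hunc
    simp only [mk_prod, Cardinal.lift_uzero, Cardinal.mk_nat, Cardinal.lift_aleph0]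
    exact Cardinal.mul_lt_of_lt h2.le h2 (mk_sequences_lt hunc hlim hν)
  have : ∀ p : ℕ × (Iio ν → Iio (max ω ν)), ∃ b < κ.ord, ∀ z, ∀ hz : IsBoundedBelow ν z,
      hz.restr = p.2 → Q p.1 z b := by
    intro p
    by_cases hex : ∃ z, ∃ hz : IsBoundedBelow ν z, hz.restr = p.2
    · obtain ⟨z, hz, hzp⟩ := hex
      obtain ⟨b, hb, hq⟩ := h p.1 z hz
      refine ⟨b, hb, fun z' hz' h' => hQ p.1 z z' (fun i hi => ?_) b hq⟩
      have := congrFun (h'.trans hzp.symm) ⟨i, hi⟩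
      exact congrArg Subtype.val this
    · exact ⟨0, (isSuccLimit_ord hreg.aleph0_le).bot_lt, fun z hz h' => absurd ⟨z, hz, h'⟩ hex⟩
  choose F hF hQF using this
  obtain ⟨b, hb, hFb⟩ := exists_bound hreg hι F hF
  exact ⟨b, hb, fun k z hz => ⟨_, hFb (k, hz.restr), hQF (k, hz.restr) z hz rfl⟩⟩

/-- Nodes of length less than `κ` can be coded injectively by ordinals below `κ`. -/
theorem exists_node_code (hunc : Cardinal.aleph0 < κ)
    (hlim : ∀ c < κ, 2 ^ c < κ) :
    ∃ code : Ordinal.{u} → (Ordinal.{u} → Ordinal.{u}) → Ordinal.{u},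
      (∀ ν z z', (∀ i < ν, z' i = z i) → code ν z' = code ν z) ∧
      (∀ ν < κ.ord, ∀ z, IsBoundedBelow ν z → code ν z < κ.ord) ∧
      ∀ ν < κ.ord, ∀ z, IsBoundedBelow ν z → ∀ ν' < κ.ord, ∀ z', IsBoundedBelow ν' z' →
        code ν z = code ν' z' → ν = ν' ∧ ∀ i < ν, z i = z' i := by
  have hκ : #(Iio κ.ord) = lift.{u + 1} κ := by rw [Cardinal.mk_Iio_ordinal, card_ord]
  have hle : #(Σ ν : Iio κ.ord, (Iio ν.1 → Iio (max ω ν.1))) ≤ #(Iio κ.ord) := by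
    rw [Cardinal.mk_sigma]
    refine (Cardinal.sum_le_sum _ (fun _ => lift.{u + 1} κ)
      fun ν => (mk_sequences_lt hunc hlim ν.2).le).trans ?_
    rw [Cardinal.sum_const', hκ, Cardinal.mul_eq_self]
    simpa using hunc.le
  obtain ⟨e⟩ := (Cardinal.le_def _ _).1 hle
  classical
  refine ⟨fun ν z => if h : ν < κ.ord ∧ IsBoundedBelow ν z then (e ⟨⟨ν, h.1⟩, h.2.restr⟩).1 else 0,
    fun ν z z' h => ?_, fun ν hν z hz => ?_, fun ν hν z hz ν' hν' z' hz' h => ?_⟩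
  · have hiff : IsBoundedBelow ν z' ↔ IsBoundedBelow ν z :=
      forall₂_congr fun i hi => by rw [h i hi]
    by_cases hz : ν < κ.ord ∧ IsBoundedBelow ν z
    · have hz' : ν < κ.ord ∧ IsBoundedBelow ν z' := ⟨hz.1, hiff.2 hz.2⟩
      have : hz'.2.restr = hz.2.restr := funext fun i => Subtype.ext (h i.1 i.2)
      simp only [dif_pos hz, dif_pos hz', this]
    · have hz' : ¬ (ν < κ.ord ∧ IsBoundedBelow ν z') := fun h' => hz ⟨h'.1, hiff.1 h'.2⟩
      simp only [dif_neg hz, dif_neg hz']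
  · simp only [dif_pos (And.intro hν hz)]
    exact (e _).2
  · simp only [dif_pos (And.intro hν hz), dif_pos (And.intro hν' hz')] at h
    have := e.injective (Subtype.ext h)
    obtain ⟨h1, h2⟩ := Sigma.mk.inj_iff.1 this
    obtain rfl : ν = ν' := congrArg Subtype.val h1
    have h3 := eq_of_heq h2
    exact ⟨rfl, fun i hi => congrArg Subtype.val (congrFun h3 ⟨i, hi⟩)⟩

/-! ### Excluding antichains of unbounded height. -/

/-- The nodes above some member of `X`, or below no member of `X` (besides those on their own
level). -/
def Decides (X : Set (Ordinal.{u} × (Ordinal.{u} → Ordinal.{u}))) (ν : Ordinal.{u})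
    (t : Ordinal.{u} → Ordinal.{u}) : Prop :=
  (∃ p ∈ X, p.1 ≤ ν ∧ ∀ i < p.1, p.2 i = t i) ∨ ∀ p ∈ X, ν < p.1 → ∃ i < ν, p.2 i ≠ t i

theorem Decides.isLocal (X : Set (Ordinal.{u} × (Ordinal.{u} → Ordinal.{u}))) :
    IsLocal (Decides X) := by
  rintro ν z z' h (⟨p, hp, h1, h2⟩ | h2)
  · exact Or.inl ⟨p, hp, h1, fun i hi => (h2 i hi).trans (h i (hi.trans_le h1)).symm⟩
  · refine Or.inr fun p hp hν => ?_
    obtain ⟨i, hi, hne⟩ := h2 p hp hν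
    exact ⟨i, hi, by rwa [h i hi]⟩

theorem Decides.mono {X : Set (Ordinal.{u} × (Ordinal.{u} → Ordinal.{u}))} {ν ν' : Ordinal.{u}}
    {t : Ordinal.{u} → Ordinal.{u}} (h : Decides X ν t) (hν : ν ≤ ν') : Decides X ν' t := by
  rcases h with ⟨p, hp, h1, h2⟩ | h
  · exact Or.inl ⟨p, hp, h1.trans hν, h2⟩
  · refine Or.inr fun p hp hlt => ?_
    obtain ⟨i, hi, hne⟩ := h p hp (hν.trans_lt hlt)
    exact ⟨i, hi.trans_le hν, hne⟩

/-- An antichain with members on cofinally many levels. -/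
structure IsUnboundedAntichain (κ : Cardinal.{u})
    (T : Ordinal.{u} → (Ordinal.{u} → Ordinal.{u}) → Prop)
    (X : Set (Ordinal.{u} × (Ordinal.{u} → Ordinal.{u}))) : Prop where
  lt : ∀ p ∈ X, p.1 < κ.ord
  mem : ∀ p ∈ X, T p.1 p.2
  anti : ∀ p ∈ X, ∀ q ∈ X, p.1 < q.1 → ∃ i < p.1, p.2 i ≠ q.2 i
  unbounded : ∀ ξ < κ.ord, ∃ p ∈ X, ξ < p.1

theorem IsUnboundedAntichain.not_decides {T : Ordinal.{u} → (Ordinal.{u} → Ordinal.{u}) → Prop}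
    {X : Set (Ordinal.{u} × (Ordinal.{u} → Ordinal.{u}))} (hX : IsUnboundedAntichain κ T X)
    {p : Ordinal.{u} × (Ordinal.{u} → Ordinal.{u})} (hp : p ∈ X) {α : Ordinal.{u}}
    (hα : α < p.1) : ¬ Decides X α p.2 := by
  rintro (⟨q, hq, h1, h2⟩ | h)
  · obtain ⟨i, hi, hne⟩ := hX.anti q hq p hp (h1.trans_lt hα)
    exact hne (h2 i hi)
  · obtain ⟨i, _, hne⟩ := h p hp hα
    exact hne rfl

/-- An undecided node lies strictly below some member of `X`, and that member decides. -/
theorem IsUnboundedAntichain.dense {T : Ordinal.{u} → (Ordinal.{u} → Ordinal.{u}) → Prop}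
    {X : Set (Ordinal.{u} × (Ordinal.{u} → Ordinal.{u}))} (hX : IsUnboundedAntichain κ T X)
    {η : Ordinal.{u}} (hη : η < κ.ord) {y : Ordinal.{u} → Ordinal.{u}} (hy : T η y) :
    ∃ ν < κ.ord, η ≤ ν ∧ ∃ z, T ν z ∧ (∀ i < η, z i = y i) ∧ Decides X ν z := by
  by_cases h : Decides X η y
  · exact ⟨η, hη, le_rfl, y, hy, fun _ _ => rfl, h⟩
  · simp only [Decides, not_or, not_forall] at h
    obtain ⟨_, p, hp, hlt, hne⟩ := h
    refine ⟨p.1, hX.lt p hp, hlt.le, p.2, hX.mem p hp, fun i hi => ?_,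
      Or.inl ⟨p, hp, le_rfl, fun _ _ => rfl⟩⟩
    by_contra hcon
    exact hne ⟨i, hi, hcon⟩

/-- It contradicts subtlety that, on a club of levels of uncountable cofinality, one of countably
many trees omits a branch. -/
theorem IsSubtle.false_of_omitted (hreg : κ.IsRegular) (hunc : Cardinal.aleph0 < κ)
    (hsub : IsSubtle κ) {om : ℕ → Ordinal.{u} → Option (Ordinal.{u} → Ordinal.{u})}
    (hom : ∀ k δ b, om k δ = some b → ∀ β < δ, Level (om k) β b)
    {P : Ordinal.{u} → Prop} (hP : OnClub κ P)
    (h : ∀ α < κ.ord, P α → UncountableCof α → ∃ k b, om k α = some b) : False := by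
  classical
  have hω : OnClub κ fun δ => ω < δ :=
    ⟨fun _ => ω, fun _ _ => omega0_lt_ord hunc, fun δ _ h0 h => h 0 h0⟩
  have hchoice : ∀ α : Ordinal.{u}, ∃ (k : ℕ) (b : Ordinal.{u} → Ordinal.{u})
      (c : ℕ → Ordinal.{u}), α < κ.ord → P α → 0 < α →
        (UncountableCof α → om k α = some b) ∧
        (¬ UncountableCof α → (∀ n, c n < α) ∧ ∀ ξ < α, ∃ n, ξ ≤ c n) := by
    intro α
    by_cases hα : α < κ.ord ∧ P α ∧ 0 < α
    · by_cases hu : UncountableCof α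
      · obtain ⟨k, b, hb⟩ := h α hα.1 hα.2.1 hu
        exact ⟨k, b, fun _ => 0, fun _ _ _ => ⟨fun _ => hb, fun h => absurd hu h⟩⟩
      · have := hu
        simp only [UncountableCof, hα.2.2, true_and, not_not] at this
        obtain ⟨c, hc⟩ := this
        exact ⟨0, id, c, fun _ _ _ => ⟨fun h => absurd h hu, fun _ => hc⟩⟩
    · exact ⟨0, id, fun _ => 0, fun h1 h2 h3 => absurd ⟨h1, h2, h3⟩ hα⟩
  choose k b c hkbc using hchoice
  -- Slot `0` records the type of cofinality, slot `1` the index of the tree, and the others the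
  -- omitted branch or a cofinal `ω`-sequence.
  let R : Ordinal.{u} → ℕ → Ordinal.{u} → Ordinal.{u} := fun α n i =>
    match n with
    | 0 => if UncountableCof α then 1 else 0
    | 1 => if UncountableCof α then (k α : Ordinal.{u}) else 0
    | n + 2 => if UncountableCof α then b α i else c α n
  have hR : ∀ α < κ.ord, P α ∧ ω < α → ∀ n, ∀ i < α, R α n i < α := by
    rintro α hα ⟨hPα, hωα⟩ n i hi
    have h0 : 0 < α := omega0_pos.trans hωα
    obtain ⟨h1, h2⟩ := hkbc α hα hPα h0
    by_cases hu : UncountableCof α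
    · match n with
      | 0 => simp only [R, if_pos hu]; exact one_lt_omega0.trans hωα
      | 1 => simp only [R, if_pos hu]; exact (natCast_lt_omega0 _).trans hωα
      | n + 2 =>
        simp only [R, if_pos hu]
        have := hom _ _ _ (h1 hu)
        by_contra hcon
        have hmax : max ω i < α := max_lt hωα hi
        have hs : Order.succ i < α := by
          refine lt_of_le_of_ne (Order.succ_le_of_lt hi) fun h => ?_
          rw [← h] at hu
          exact not_uncountableCof_succ i hu
        exact hcon (((this _ hs).1 i (Order.lt_succ i)).trans hmax)
    · match n with
      | 0 => simp only [R, if_neg hu]; exact h0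
      | 1 => simp only [R, if_neg hu]; exact h0
      | n + 2 => simp only [R, if_neg hu]; exact (h2 hu).1 n
  obtain ⟨β, α, hlt, h0, hα, ⟨hPβ, hωβ⟩, ⟨hPα, hωα⟩, heq⟩ :=
    hsub.exists_eq_below hreg hunc (hP.and hω) hR
  obtain ⟨hα1, hα2⟩ := hkbc α hα hPα (h0.trans hlt)
  obtain ⟨hβ1, hβ2⟩ := hkbc β (hlt.trans hα) hPβ h0
  by_cases hu : UncountableCof α
  · have hu' : UncountableCof β := by
      by_contra hu'
      have := heq 0 0 h0
      simp [R, hu, hu'] at this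
    have hk : k β = k α := by
      have := heq 1 0 h0
      simpa [R, hu, hu'] using this
    -- The branch omitted at `α` passes through level `β` of the same tree, so it must differ below
    -- `β` from the branch omitted there.
    obtain ⟨i, hi, hne⟩ := (hom _ _ _ (hα1 hu) β hlt).2 β le_rfl (b β) (hk ▸ hβ1 hu')
    have := heq 2 i hi
    simp only [R, if_pos hu, if_pos hu'] at this
    exact hne this.symm
  · have hu' : ¬ UncountableCof β := by
      intro hu'
      have := heq 0 0 h0
      simp [R, hu, hu'] at this
    obtain ⟨n, hn⟩ := (hα2 hu).2 β hlt
    have := heq (n + 2) 0 h0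
    simp only [R, if_neg hu, if_neg hu'] at this
    rw [← this] at hn
    exact absurd ((hβ2 hu').1 n) (not_lt.2 hn)

theorem exists_omTree_no_antichain (hreg : κ.IsRegular) (hunc : Cardinal.aleph0 < κ)
    (hsub : IsSubtle κ) (hC : IsLadder κ C) :
    ∃ g D k, (∀ b, IsLocal (D b)) ∧ ¬ ∃ X, IsUnboundedAntichain κ (OmTree C g D k) X := by
  have hlim : ∀ c < κ, 2 ^ c < κ := fun c hc => hsub.two_power_lt hreg hunc hc
  obtain ⟨code, hloc, hcode, hinj⟩ := exists_node_code hunc hlim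
  obtain ⟨G, hG⟩ := hsub.exists_guess hreg hunc
  -- Slot `0` guesses a function bounding the search for deciding nodes; slot `k + 1` guesses the
  -- coded set of nodes deciding the antichain of tree `k`.
  let g : Ordinal.{u} → Ordinal.{u} → Ordinal.{u} := fun β => G β 0
  let D : ℕ → Ordinal.{u} → Ordinal.{u} → (Ordinal.{u} → Ordinal.{u}) → Prop :=
    fun k β ν z => G β (k + 1) (code ν z) = 1
  have hD : ∀ k b, IsLocal (D k b) := fun k b ν z z' h hz => by
    simp only [D, hloc ν z z' h]
    exact hz
  by_contra hcon
  have hX : ∀ k, ∃ X, IsUnboundedAntichain κ (OmTree C g (D k) k) X := by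
    intro k
    by_contra h
    exact hcon ⟨g, D k, k, hD k, h⟩
  choose X hX using hX
  have hκ := isSuccLimit_ord hreg.aleph0_le
  -- Below `gs η`, every node of level `η` in every one of the trees has a deciding extension.
  have hgs : ∀ η : Ordinal.{u}, ∃ ζ, η < κ.ord → ζ < κ.ord ∧ η < ζ ∧
      ∀ k y, OmTree C g (D k) k η y → ∃ ν < ζ, η ≤ ν ∧ ∃ z, OmTree C g (D k) k ν z ∧
        (∀ i < η, z i = y i) ∧ Decides (X k) ν z := by
    intro η
    by_cases hη : η < κ.ord
    swap
    · exact ⟨0, fun h => absurd h hη⟩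
    obtain ⟨b, hb, h⟩ := exists_bound_level hreg hunc hlim hη
      (Q := fun k y ν => OmTree C g (D k) k η y → η ≤ ν ∧ ∃ z, OmTree C g (D k) k ν z ∧
        (∀ i < η, z i = y i) ∧ Decides (X k) ν z)
      (fun k y y' hy ν h hT => by
        obtain ⟨h1, z, h2, h3, h4⟩ := h (Level.congr hT fun i hi => (hy i hi).symm)
        exact ⟨h1, z, h2, fun i hi => (h3 i hi).trans (hy i hi).symm, h4⟩)
      (fun k y _ => by
        by_cases hT : OmTree C g (D k) k η y
        · obtain ⟨ν, h1, h2⟩ := (hX k).dense hη hT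
          exact ⟨ν, h1, fun _ => h2⟩
        · exact ⟨0, hκ.bot_lt, fun h => absurd h hT⟩)
    refine ⟨max b (Order.succ η), fun _ => ⟨max_lt hb (hκ.succ_lt hη), by simp, fun k y hy => ?_⟩⟩
    obtain ⟨ν, h1, h2⟩ := h k y hy.1
    exact ⟨ν, h1.trans_le (le_max_left _ _), h2 hy⟩
  choose gs hgs using hgs
  classical
  let F : ℕ → Ordinal.{u} → Ordinal.{u} := fun n => match n with
    | 0 => gs
    | k + 1 => fun i => if ∃ ν < κ.ord, ∃ z, IsBoundedBelow ν z ∧ i = code ν z ∧ Decides (X k) ν z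
        then 1 else 0
  have hF : ∀ n, ∀ i < κ.ord, F n i < κ.ord := by
    intro n i hi
    match n with
    | 0 => exact (hgs i hi).1
    | k + 1 =>
      simp only [F]
      split_ifs
      exacts [one_lt_omega0.trans (omega0_lt_ord hunc), hκ.bot_lt]
  -- The levels where all guesses are correct. Closure under node codes ensures that the guess at
  -- `β` speaks about all nodes below `β`.
  let B : Set Ordinal.{u} := {β | β < κ.ord ∧ (∀ n, ∀ i < β, F n i = G β n i) ∧
    (∀ ξ < β, gs ξ < β) ∧ ∀ ν < β, ∃ b < β, ∀ _ : ℕ, ∀ z, IsBoundedBelow ν z → ∃ b' < b,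
      code ν z = b'}
  have hBclub : OnClub κ fun β => (∀ ξ < β, gs ξ < β) ∧
      ∀ ν < β, ∃ b < β, ∀ _ : ℕ, ∀ z, IsBoundedBelow ν z → ∃ b' < b, code ν z = b' := by
    refine (onClub_closed fun ξ hξ => (hgs ξ hξ).1).and (onClub_exists_lt fun ν hν => ?_)
    exact exists_bound_level hreg hunc hlim hν (Q := fun _ z b => code ν z = b)
      (fun _ z z' h b hb => by rw [hloc ν z z' h, hb])
      fun _ z hz => ⟨_, hcode ν hν z hz, rfl⟩
  have hBunb : ∀ ξ < κ.ord, ∃ e ∈ B, ξ < e ∧ e < κ.ord := by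
    intro ξ hξ
    obtain ⟨β, hβ, ⟨h1, h2⟩, h3⟩ := hG F hF _ (hBclub.and
      ⟨fun _ => ξ, fun _ _ => hξ, fun δ _ h0 h => h 0 h0⟩)
    exact ⟨β, ⟨hβ, h3, h1⟩, h2, hβ⟩
  have hBg : ∀ β ∈ B, ∀ ξ < β, g β ξ = gs ξ := fun β hβ ξ hξ => (hβ.2.1 0 ξ hξ).symm
  have hBclimb : ∀ β ∈ B, ∀ ξ < β, ξ < g β ξ ∧ g β ξ < β := fun β hβ ξ hξ => by
    rw [hBg β hβ ξ hξ]
    exact ⟨(hgs ξ (hξ.trans hβ.1)).2.1, hβ.2.2.1 ξ hξ⟩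
  have hBD : ∀ β ∈ B, ∀ k, ∀ ν < β, ∀ z, IsBoundedBelow ν z →
      (D k β ν z ↔ Decides (X k) ν z) := by
    intro β hβ k ν hν z hz
    obtain ⟨b, hb, h⟩ := hβ.2.2.2 ν hν
    obtain ⟨b', hb', hcb⟩ := h 0 z hz
    have hlt : code ν z < β := hcb ▸ hb'.trans hb
    have := hβ.2.1 (k + 1) _ hlt
    simp only [D, ← this, F]
    constructor
    · intro hif
      split_ifs at hif with hex
      · obtain ⟨ν', hν', z', hz', he, hd⟩ := hex
        obtain ⟨rfl, hzz⟩ := hinj ν (hν.trans hβ.1) z hz ν' hν' z' hz' he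
        exact Decides.isLocal _ _ _ _ hzz hd
      · simp at hif
    · intro hd
      exact if_pos ⟨ν, hν.trans hβ.1, z, hz, rfl, hd⟩
  have hΓ : ∀ ξ < κ.ord, ∃ e ∈ {γ | HitsAt C B γ}, ξ < e ∧ e < κ.ord := by
    intro ξ hξ
    obtain ⟨γ, h1, h2, h3⟩ := hC.guess B hBunb (fun γ => ξ < γ)
      ⟨fun _ => ξ, fun _ _ => hξ, fun δ _ h0 h => h 0 h0⟩
    exact ⟨γ, h3, h2, h1⟩
  refine hsub.false_of_omitted hreg hunc (om := fun k => omitted C g (D k) k)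
    (fun k δ b hb => (omitted_of_some hC.lt (hD k) hb).2.1) (onClub_isLimitOf hΓ)
    fun α hα hl hu => ?_
  obtain ⟨k, hk⟩ := HasTaskAt.exists_uniform hC hBclimb hα hu hl
  obtain ⟨p, hp, hαp⟩ := (hX k).unbounded α hα
  have hpT := (hX k).mem p hp
  -- If `p.2` were canonical at `α`, it would meet a correctly guessed demand and decide `X k` below
  -- its own height.
  suffices hcan : ¬ IsCanonical C g (D k) k (OmTree C g (D k) k) α p.2 from
    ⟨k, Omittable.exists_omitted hC.lt (hD k)
      ⟨hu, fun β hβ => Level.mono hpT (hβ.trans hαp).le, hcan⟩⟩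
  rintro ⟨ξ, hξ, hmeets⟩
  obtain ⟨η, β, hβB, ht⟩ := hk ξ hξ
  obtain ⟨h1, h2, h3⟩ := ht.bounds hC.lt
  have hβp : β < p.1 := h3.trans hαp
  have hηβ := h1.trans h2
  have hgη := hBg β hβB η hηβ
  obtain ⟨ν, hν, hην, z, hz1, hz2, hz3⟩ := (hgs η (hηβ.trans hβB.1)).2.2 k p.2
    (Level.mono hpT (hηβ.trans hβp).le)
  rw [← hgη] at hν
  obtain ⟨ν', hν', hd⟩ := hmeets η _ β ht ⟨ν, hν, z, hην, hz1, hz2,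
    (hBD β hβB k ν (hν.trans h2) z hz1.1).2 hz3⟩
  have hν'β := hν'.trans h2
  have hd' := (hBD β hβB k ν' hν'β p.2 (Level.mono hpT (hν'β.trans hβp).le).1).1 hd
  exact (hX k).not_decides hp hαp (hd'.mono (hν'β.trans h3).le)

/-! ### Transfer to streamlined trees. -/

theorem eq_of_Iio_orderIso {a b : Ordinal.{u}} (e : Iio a ≃o Iio b) : a = b := by
  simpa using e.toRelIsoLT.ordinalType_congr

theorem TransSeq.le_total_of_le {s t w : TransSeq.{u}} (hs : s ≤ w) (ht : t ≤ w) :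
    s ≤ t ∨ t ≤ s := by
  rcases le_total s.dom t.dom with h | h
  · exact Or.inl ⟨h, fun x => (hs.2 x).trans (ht.2 ⟨x.1, lt_of_lt_of_le x.2 h⟩).symm⟩
  · exact Or.inr ⟨h, fun x => (ht.2 x).trans (hs.2 ⟨x.1, lt_of_lt_of_le x.2 h⟩).symm⟩

/-- The sequence of von Neumann ordinals given by the values of `f` below `α`. -/
noncomputable def seqOf (α : Ordinal.{u}) (f : Ordinal.{u} → Ordinal.{u}) : TransSeq.{u} :=
  ⟨α, fun x => (f x.1).toZFSet⟩

theorem seqOf_le_iff {α β : Ordinal.{u}} {f h : Ordinal.{u} → Ordinal.{u}} :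
    seqOf α f ≤ seqOf β h ↔ α ≤ β ∧ ∀ i < α, f i = h i := by
  constructor
  · rintro ⟨h1, h2⟩
    exact ⟨h1, fun i hi => toZFSet_injective (h2 ⟨i, hi⟩)⟩
  · rintro ⟨h1, h2⟩
    exact ⟨h1, fun x => congrArg toZFSet (h2 x.1 x.2)⟩

theorem seqOf_congr {α : Ordinal.{u}} {f h : Ordinal.{u} → Ordinal.{u}} (H : ∀ i < α, f i = h i) :
    seqOf α f = seqOf α h :=
  le_antisymm (seqOf_le_iff.2 ⟨le_rfl, H⟩) (seqOf_le_iff.2 ⟨le_rfl, fun i hi => (H i hi).symm⟩)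

theorem seqOf_eq_iff {α β : Ordinal.{u}} {f h : Ordinal.{u} → Ordinal.{u}} :
    seqOf α f = seqOf β h ↔ α = β ∧ ∀ i < α, f i = h i := by
  constructor
  · intro H
    have h1 := seqOf_le_iff.1 H.le
    have h2 := seqOf_le_iff.1 H.ge
    exact ⟨le_antisymm h1.1 h2.1, h1.2⟩
  · rintro ⟨rfl, H⟩
    exact seqOf_congr H

theorem restrict_seqOf (α β : Ordinal.{u}) (f : Ordinal.{u} → Ordinal.{u}) :
    (seqOf α f).restrict β = seqOf (min β α) f := rfl

theorem snoc_seqOf (α i : Ordinal.{u}) (f : Ordinal.{u} → Ordinal.{u}) :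
    (seqOf α f).snoc i.toZFSet = seqOf (Order.succ α) (Function.update f α i) := by
  simp only [TransSeq.snoc, seqOf, TransSeq.mk.injEq, heq_eq_eq, true_and]
  funext x
  by_cases hx : x.1 < α
  · simp [hx, hx.ne]
  · have : x.1 = α := le_antisymm (Order.lt_succ_iff.1 x.2) (not_lt.1 hx)
    simp [this]

/-- The set of sequences given by the levels of a tree. -/
def treeSet (κ : Cardinal.{u}) (om : Ordinal.{u} → Option (Ordinal.{u} → Ordinal.{u})) :
    Set TransSeq.{u} :=
  {t | ∃ α < κ.ord, ∃ f, Level om α f ∧ seqOf α f = t}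

variable {om : Ordinal.{u} → Option (Ordinal.{u} → Ordinal.{u})}

theorem seqOf_mem_treeSet {α : Ordinal.{u}} {f : Ordinal.{u} → Ordinal.{u}} :
    seqOf α f ∈ treeSet κ om ↔ α < κ.ord ∧ Level om α f := by
  constructor
  · rintro ⟨β, hβ, h, hh, heq⟩
    obtain ⟨rfl, H⟩ := seqOf_eq_iff.1 heq
    exact ⟨hβ, hh.congr fun i hi => (H i hi).symm⟩
  · rintro ⟨h1, h2⟩
    exact ⟨α, h1, f, h2, rfl⟩

theorem hasHeight_dom (x : treeSet κ om) : HasHeight x x.1.dom := by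
  obtain ⟨_, α, hα, f, hf, rfl⟩ := x
  have hmem : ∀ β < α, seqOf β f ∈ treeSet κ om := fun β hβ =>
    seqOf_mem_treeSet.2 ⟨hβ.trans hα, hf.mono hβ.le⟩
  have hlt : ∀ β < α, seqOf β f < seqOf α f := fun β hβ =>
    lt_of_le_of_ne (seqOf_le_iff.2 ⟨hβ.le, fun _ _ => rfl⟩) fun h => hβ.ne (seqOf_eq_iff.1 h).1
  have hback : ∀ t : treeSet κ om, t.1 < seqOf α f → t.1.dom < α ∧ t.1 = seqOf t.1.dom f := by
    rintro ⟨_, β, hβ, h, hh, rfl⟩ ht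
    obtain ⟨h1, h2⟩ := seqOf_le_iff.1 ht.le
    have h3 : seqOf β h = seqOf β f := seqOf_congr h2
    exact ⟨lt_of_le_of_ne h1 fun heq => ht.ne (heq ▸ h3), h3⟩
  exact ⟨{
    toFun := fun y => ⟨y.1.1.dom, (hback y.1 y.2).1⟩
    invFun := fun β => ⟨⟨seqOf β.1 f, hmem _ β.2⟩, hlt _ β.2⟩
    left_inv := fun y => Subtype.ext (Subtype.ext (hback y.1 y.2).2.symm)
    right_inv := fun β => rfl
    map_rel_iff' := by
      intro y z
      refine ⟨fun h => ?_, fun h => h.1⟩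
      show y.1.1 ≤ z.1.1
      rw [(hback y.1 y.2).2, (hback z.1 z.2).2]
      exact seqOf_le_iff.2 ⟨h, fun _ _ => rfl⟩ }⟩

theorem hasHeight_iff {x : treeSet κ om} {α : Ordinal.{u}} : HasHeight x α ↔ x.1.dom = α := by
  constructor
  · rintro ⟨e⟩
    obtain ⟨e'⟩ := hasHeight_dom x
    exact eq_of_Iio_orderIso (e'.symm.trans e)
  · rintro rfl
    exact hasHeight_dom x

theorem mk_level_lt (hunc : Cardinal.aleph0 < κ) (hlim : ∀ c < κ, 2 ^ c < κ)
    {α : Ordinal.{u}} (hα : α < κ.ord) :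
    #{t : TransSeq.{u} | t ∈ treeSet κ om ∧ t.dom = α} < lift.{u + 1} κ := by
  refine lt_of_le_of_lt ?_ (mk_sequences_lt hunc hlim hα)
  let φ : (Iio α → Iio (max ω α)) → TransSeq.{u} := fun h => ⟨α, fun x => (h x).1.toZFSet⟩
  refine (Cardinal.mk_le_mk_of_subset (t := range φ) ?_).trans Cardinal.mk_range_le
  rintro _ ⟨⟨β, hβ, f, hf, rfl⟩, hdom⟩
  obtain rfl : β = α := hdom
  exact ⟨IsBoundedBelow.restr hf.1, rfl⟩

/-- The tree of sequences with levels `Level om` has all required closure properties. -/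
structure IsGoodOmission (κ : Cardinal.{u})
    (om : Ordinal.{u} → Option (Ordinal.{u} → Ordinal.{u})) : Prop where
  zero : Level om 0 id
  snoc : ∀ α f f', Level om α f → (∀ i < α, f' i = f i) → f' α < max ω α →
    Level om (Order.succ α) f'
  extend : ∀ α < κ.ord, ∀ ξ ≤ α, ∀ x, Level om ξ x → ∃ f, Level om α f ∧ ∀ i < ξ, f i = x i

theorem IsGoodOmission.level_nonempty (h : IsGoodOmission κ om) {α : Ordinal.{u}}
    (hα : α < κ.ord) : ∃ f, Level om α f := by
  obtain ⟨f, hf, _⟩ := h.extend α hα 0 bot_le _ h.zero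
  exact ⟨f, hf⟩

theorem toZFSet_mem_HSet {i : Ordinal.{u}} (hi : i < κ.ord) : i.toZFSet ∈ HSet κ :=
  ⟨i.toZFSet, (ZFSet.isOrdinal_toZFSet i).isTransitive, fun _ h => h, by
    rw [card_toZFSet]
    exact lt_ord.1 hi⟩

theorem IsGoodOmission.isStreamlined (h : IsGoodOmission κ om) (hunc : Cardinal.aleph0 < κ)
    (hlim : ∀ c < κ, 2 ^ c < κ) : IsStreamlined κ (treeSet κ om) where
  seq := by
    rintro _ ⟨α, hα, f, hf, rfl⟩
    exact ⟨hα, fun x => toZFSet_mem_HSet ((hf.1 x.1 x.2).trans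
      (max_lt (omega0_lt_ord hunc) (lt_trans x.2 hα)))⟩
  restrict_mem := by
    rintro _ ⟨α, hα, f, hf, rfl⟩ β _
    rw [restrict_seqOf, seqOf_mem_treeSet]
    exact ⟨(min_le_right _ _).trans_lt hα, hf.mono (min_le_right _ _)⟩
  level_nonempty := fun α hα => by
    obtain ⟨f, hf⟩ := h.level_nonempty hα
    exact ⟨seqOf α f, seqOf_mem_treeSet.2 ⟨hα, hf⟩, rfl⟩
  level_card := fun α hα => mk_level_lt hunc hlim hα

theorem IsGoodOmission.isProlific (h : IsGoodOmission κ om) (hκ : Order.IsSuccLimit κ.ord) :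
    IsProlific (treeSet κ om) := by
  rintro _ ⟨α, hα, f, hf, rfl⟩ i hi
  rw [snoc_seqOf, seqOf_mem_treeSet]
  exact ⟨hκ.succ_lt hα, h.snoc α f _ hf (fun j hj => Function.update_of_ne hj.ne _ _)
    (by rw [Function.update_self]; exact hi)⟩

theorem IsGoodOmission.isNormalTree (h : IsGoodOmission κ om) :
    IsNormalTree (treeSet κ om) κ := by
  rintro α hα β hβ ⟨_, γ, hγ, f, hf, rfl⟩ hx
  obtain rfl : γ = β := hasHeight_iff.1 hx
  obtain ⟨f', h1, h2⟩ := h.extend α hα γ hβ.le f hf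
  refine ⟨⟨seqOf α f', seqOf_mem_treeSet.2 ⟨hα, h1⟩⟩, hasHeight_iff.2 rfl, ?_⟩
  refine lt_of_le_of_ne (seqOf_le_iff.2 ⟨hβ.le, fun i hi => (h2 i hi).symm⟩) fun heq => ?_
  exact hβ.ne (seqOf_eq_iff.1 (congrArg Subtype.val heq)).1

/-- The nodes of a branch cohere, so their union is one function, and the branch is exactly the set
of its restrictions. -/
theorem IsBranch.exists_fun {α : Ordinal.{u}}
    {B : Set (treeSet κ om)} (hB : IsBranch α B) :
    ∃ f, (∀ β < α, Level om β f) ∧ ∀ x : treeSet κ om, x ∈ B ↔ ∃ β < α, x.1 = seqOf β f := by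
  have hex : ∀ β : Ordinal.{u}, ∃ f, β < α → Level om β f ∧ ∃ x ∈ B, x.1 = seqOf β f := by
    intro β
    by_cases hβ : β < α
    · obtain ⟨⟨_, γ, hγ, f, hf, rfl⟩, hx, hh⟩ := (hB.2 β).2 hβ
      obtain rfl : γ = β := hasHeight_iff.1 hh
      exact ⟨f, fun _ => ⟨hf, _, hx, rfl⟩⟩
    · exact ⟨id, fun h => absurd h hβ⟩
  choose F hF using hex
  have hag : ∀ β γ, β ≤ γ → γ < α → ∀ i < β, F β i = F γ i := by
    intro β γ hβγ hγ i hi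
    obtain ⟨_, x, hx, hxe⟩ := hF β (hβγ.trans_lt hγ)
    obtain ⟨_, y, hy, hye⟩ := hF γ hγ
    rcases hB.1.total hx hy with h | h
    · have : x.1 ≤ y.1 := h
      rw [hxe, hye] at this
      exact (seqOf_le_iff.1 this).2 i hi
    · have : y.1 ≤ x.1 := h
      rw [hxe, hye] at this
      obtain ⟨h1, h2⟩ := seqOf_le_iff.1 this
      exact (h2 i (hi.trans_le hβγ)).symm
  let f : Ordinal.{u} → Ordinal.{u} := fun i => F (Order.succ i) i
  have hf : ∀ β < α, ∀ i < β, f i = F β i := fun β hβ i hi =>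
    hag _ β (Order.succ_le_of_lt hi) hβ i (Order.lt_succ i)
  refine ⟨f, fun β hβ => (hF β hβ).1.congr (hf β hβ), fun x => ⟨fun hx => ?_, ?_⟩⟩
  · have hβ := (hB.2 x.1.dom).1 ⟨x, hx, hasHeight_dom x⟩
    obtain ⟨_, y, hy, hye⟩ := hF _ hβ
    have hdom : y.1.dom = x.1.dom := by rw [hye]; rfl
    refine ⟨_, hβ, ?_⟩
    rw [seqOf_congr (hf _ hβ), ← hye]
    obtain ⟨_, γ, hγ, h, hh, rfl⟩ := x
    rw [hye]
    rcases hB.1.total hx hy with hle | hle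
    · have : seqOf γ h ≤ y.1 := hle
      rw [hye] at this
      exact seqOf_congr (seqOf_le_iff.1 this).2
    · have : y.1 ≤ seqOf γ h := hle
      rw [hye] at this
      exact seqOf_congr fun i hi => ((seqOf_le_iff.1 this).2 i hi).symm
  · rintro ⟨β, hβ, hx⟩
    obtain ⟨_, y, hy, hye⟩ := hF β hβ
    have : x = y := Subtype.ext (by rw [hx, hye, seqOf_congr (hf β hβ)])
    rwa [this]

/-- A branch through all levels below `α` can fail to be a node at `α` only by being the single
branch omitted at `α`. -/
theorem isFull_treeSet : IsFull (treeSet κ om) κ := by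
  intro α hα hlim
  have key : ∀ B : Set (treeSet κ om), IsBranch α B → IsVanishing B →
      ∃ b, om α = some b ∧ ∀ x : treeSet κ om, x ∈ B ↔ ∃ β < α, x.1 = seqOf β b := by
    intro B hB hv
    obtain ⟨f, hf, hBf⟩ := hB.exists_fun
    have hnot : ¬ Level om α f := by
      intro h
      refine hv ⟨⟨seqOf α f, seqOf_mem_treeSet.2 ⟨hα, h⟩⟩, fun x hx => ?_⟩
      obtain ⟨β, hβ, hxe⟩ := (hBf x).1 hx
      show x.1 ≤ seqOf α f
      rw [hxe]
      exact seqOf_le_iff.2 ⟨hβ.le, fun _ _ => rfl⟩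
    have hval : ∀ i < α, f i < max ω i := fun i hi =>
      (hf _ (hlim.succ_lt hi)).1 i (Order.lt_succ i)
    have : ∃ b, om α = some b ∧ ∀ i < α, f i = b i := by
      by_contra hcon
      refine hnot ⟨hval, fun δ hδ b hb => ?_⟩
      rcases hδ.eq_or_lt with rfl | hδ
      · by_contra h
        push Not at h
        exact hcon ⟨b, hb, h⟩
      · exact (hf δ hδ).2 δ le_rfl b hb
    obtain ⟨b, hb, hfb⟩ := this
    refine ⟨b, hb, fun x => (hBf x).trans (exists_congr fun β => and_congr_right fun hβ => ?_)⟩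
    rw [seqOf_congr fun i hi => hfb i (hi.trans hβ)]
  rintro B ⟨hB, hv⟩ B' ⟨hB', hv'⟩
  obtain ⟨b, hb, h⟩ := key B hB hv
  obtain ⟨b', hb', h'⟩ := key B' hB' hv'
  obtain rfl : b = b' := Option.some.inj (hb.symm.trans hb')
  ext x
  rw [h, h']

/-- The nodes that leave a `κ`-branch at their last value form an antichain of unbounded height. The
values `0` and `1` are always allowed, so one of them leaves the branch. -/
theorem IsGoodOmission.not_exists_branch (h : IsGoodOmission κ om)
    (hκ : Order.IsSuccLimit κ.ord) (hanti : ¬ ∃ X, IsUnboundedAntichain κ (Level om) X) :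
    ¬ ∃ B : Set (treeSet κ om), IsBranch κ.ord B := by
  rintro ⟨B, hB⟩
  obtain ⟨f, hf, -⟩ := hB.exists_fun
  classical
  let v : Ordinal.{u} → Ordinal.{u} := fun i => if f i = 0 then 1 else 0
  have hv : ∀ i, v i ≠ f i := by
    intro i
    by_cases hi : f i = 0
    · simp [v, hi]
    · simp [v, hi, Ne.symm hi]
  have hvω : ∀ i, v i < ω := by
    intro i
    simp only [v]
    split_ifs
    exacts [one_lt_omega0, omega0_pos]
  refine hanti ⟨{p | ∃ i < κ.ord, p = (Order.succ i, Function.update f i (v i))}, ?_, ?_, ?_, ?_⟩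
  · rintro _ ⟨i, hi, rfl⟩
    exact hκ.succ_lt hi
  · rintro _ ⟨i, hi, rfl⟩
    refine h.snoc i f _ (hf i hi) (fun j hj => Function.update_of_ne hj.ne _ _) ?_
    simp only [Function.update_self]
    exact (hvω i).trans_le (le_max_left _ _)
  · rintro _ ⟨i, hi, rfl⟩ _ ⟨j, hj, rfl⟩ hlt
    have hij : i < j := Order.succ_lt_succ_iff.1 hlt
    refine ⟨i, Order.lt_succ i, ?_⟩
    simpa [hij.ne] using hv i
  · intro ξ hξ
    exact ⟨_, ⟨ξ, hξ, rfl⟩, Order.lt_succ ξ⟩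

/-- If the heights are bounded by `ξ`, extending each member to level `ξ` is injective, since two
members below a common node are comparable. That level has fewer than `κ` nodes. -/
theorem IsGoodOmission.not_exists_antichain (h : IsGoodOmission κ om)
    (hunc : Cardinal.aleph0 < κ) (hlim : ∀ c < κ, 2 ^ c < κ)
    (hanti : ¬ ∃ X, IsUnboundedAntichain κ (Level om) X) :
    ¬ ∃ A : Set (treeSet κ om), IsAntichain (· ≤ ·) A ∧ lift.{u} #A = lift.{u + 1} κ := by
  rintro ⟨A, hA, hcard⟩
  rw [Cardinal.lift_id'.{u, u + 1}] at hcard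
  have hub : ∃ ξ < κ.ord, ∀ x ∈ A, x.1.dom ≤ ξ := by
    by_contra hcon
    push Not at hcon
    refine hanti ⟨{p | p.1 < κ.ord ∧ Level om p.1 p.2 ∧ ∃ x ∈ A, x.1 = seqOf p.1 p.2},
      fun p hp => hp.1, fun p hp => hp.2.1, ?_, fun ξ hξ => ?_⟩
    · rintro p ⟨_, _, x, hx, hxe⟩ q ⟨_, _, y, hy, hye⟩ hlt
      by_contra hne
      push Not at hne
      have hle : x ≤ y := by
        show x.1 ≤ y.1
        rw [hxe, hye]
        exact seqOf_le_iff.2 ⟨hlt.le, hne⟩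
      have heq := congrArg Subtype.val (hA.eq hx hy hle)
      rw [hxe, hye] at heq
      exact hlt.ne (seqOf_eq_iff.1 heq).1
    · obtain ⟨⟨_, α, hα, f, hf, rfl⟩, hx, hlt⟩ := hcon ξ hξ
      exact ⟨(α, f), ⟨hα, hf, _, hx, rfl⟩, hlt⟩
  obtain ⟨ξ, hξ, hub⟩ := hub
  have hext : ∀ x : A, ∃ f, Level om ξ f ∧ x.1.1 ≤ seqOf ξ f := by
    rintro ⟨⟨_, α, hα, f, hf, rfl⟩, hx⟩
    obtain ⟨f', h1, h2⟩ := h.extend ξ hξ α (hub _ hx) f hf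
    exact ⟨f', h1, seqOf_le_iff.2 ⟨hub _ hx, fun i hi => (h2 i hi).symm⟩⟩
  choose F hF hle using hext
  have hinj : Function.Injective fun x : A => (IsBoundedBelow.restr (hF x).1) := by
    intro x y hxy
    have hag : seqOf ξ (F x) = seqOf ξ (F y) :=
      seqOf_congr fun i hi => congrArg Subtype.val (congrFun hxy ⟨i, hi⟩)
    have hx := hle x
    have hy := hle y
    rw [hag] at hx
    rcases TransSeq.le_total_of_le hx hy with h | h
    · exact Subtype.ext (hA.eq x.2 y.2 h)
    · exact (Subtype.ext (hA.eq y.2 x.2 h)).symm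
  have := (Cardinal.mk_le_of_injective hinj).trans_lt (mk_sequences_lt hunc hlim hξ)
  exact this.ne hcard

theorem IsGoodOmission.isTreeOf (h : IsGoodOmission κ om) (hunc : Cardinal.aleph0 < κ)
    (hlim : ∀ c < κ, 2 ^ c < κ) : IsTreeOf (treeSet κ om) κ := by
  refine ⟨fun x => ⟨x.1.dom, ?_, hasHeight_dom x⟩, fun α hα => ⟨?_, ?_⟩⟩
  · obtain ⟨_, α, hα, f, hf, rfl⟩ := x
    exact hα
  · obtain ⟨f, hf⟩ := h.level_nonempty hα
    exact ⟨⟨seqOf α f, seqOf_mem_treeSet.2 ⟨hα, hf⟩⟩, hasHeight_iff.2 rfl⟩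
  · rw [Cardinal.lift_id'.{u, u + 1}]
    refine lt_of_le_of_lt ?_ (mk_level_lt (om := om) hunc hlim hα)
    refine Cardinal.mk_le_of_injective (f := fun x => ⟨x.1.1, x.1.2, hasHeight_iff.1 x.2⟩) ?_
    intro x y hxy
    have : x.1.1 = y.1.1 := by simpa using hxy
    exact Subtype.ext (Subtype.ext this)

end FullSouslin

open FullSouslin

theorem theoremA (κ : Cardinal.{u}) (hreg : κ.IsRegular) (hunc : Cardinal.aleph0 < κ)
    (hsubtle : IsSubtle κ)
    (hproxy : BoxtimesMinus κ ∨ Proxy κ InitSegStar 1 {Set.Iio κ.ord}) :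
    ∃ T : Set TransSeq.{u}, IsStreamlined κ T ∧ IsProlific T ∧
      IsNormalTree ↥T κ ∧ IsFull ↥T κ ∧ IsSouslin ↥T κ := by
  obtain ⟨C, hC⟩ : ∃ C, IsLadder κ C := by
    rcases hproxy with h | h
    · exact ProxyMinus.exists_isLadder hreg hunc (ProxyMinus.initSegStar h)
    · exact ProxyMinus.exists_isLadder hreg hunc h.1
  obtain ⟨g, D, k, hD, hanti⟩ := exists_omTree_no_antichain hreg hunc hsubtle hC
  have hlim : ∀ c < κ, 2 ^ c < κ := fun c hc => hsubtle.two_power_lt hreg hunc hc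
  have hκ := Cardinal.isSuccLimit_ord hreg.aleph0_le
  have h : IsGoodOmission κ (omitted C g D k) := by
    refine ⟨OmTree.zero hC.lt hD _, fun α f f' hf => OmTree.snoc hC.lt hD hf,
      fun α hα ξ hξ x hx => ?_⟩
    rcases hξ.eq_or_lt with rfl | hlt
    · exact ⟨x, hx, fun _ _ => rfl⟩
    · obtain ⟨f, h1, h2, _⟩ := OmTree.extendible hC hD α hα ξ hlt x hx
      exact ⟨f, h1, h2⟩
  exact ⟨treeSet κ (omitted C g D k), h.isStreamlined hunc hlim, h.isProlific hκ, h.isNormalTree,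
    isFull_treeSet, h.isTreeOf hunc hlim, h.not_exists_branch hκ hanti,
    h.not_exists_antichain hunc hlim hanti⟩
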